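/- Let $\mathcal H$ be a real Hilbert space of dimension $d\in\{1,2,\dots\}\cup\{\infty\}$ (finite or countably infinite), let $(\mathbf x,y)\sim\mathcal D$ with $\mathbf x\in\mathcal H$, $y\in\mathbb R$, and let $L(\mathbf w)=\frac12\mathbb E[(y-\langle\mathbf w,\mathbf x\rangle)^2]$, with minimizer $\mathbf w_*$. Assume: (i) the covariance $\mathbf H=\mathbb E[\mathbf x\mathbf x^\top]$ exists, is diagonal in a fixed orthonormal basis, $\mathbf H=\mathrm{diag}(\lambda_1,\lambda_2,\dots)$ with $\lambda_1\ge\lambda_2\ge\dots>0$, and $\mathrm{tr}(\mathbf H)=\sum_i\lambda_i<\infty$; (ii) the fourth moment operator $\mathcal M\circ\mathbf A=\mathbb E[\mathbf x\mathbf x^\top\mathbf A\mathbf x\mathbf x^\top]$ exists and is finite (a bounded operator for every bounded $\mathbf A$), and there is $\beta>0$ such that $\mathcal M\circ\mathbf A-\mathbf H\mathbf A\mathbf H\succeq\beta\,\mathrm{tr}(\mathbf H\mathbf A)\,\mathbf H$ for every positive semidefinite $\mathbf A$; (iii) the label noise $\xi=y-\langle\mathbf w_*,\mathbf x\rangle$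 is independent of $\mathbf x$, with $\mathbb E[\xi]=0$ and $\mathbb E[\xi^2]=\sigma^2<\infty$. Given i.i.d. samples $(\mathbf x_t,y_t)\sim\mathcal D$, a deterministic $\mathbf w_0\in\mathcal H$, a learning rate $\delta>0$ and $\alpha\in(0,1)$, let $$\mathbf w_t=\mathbf w_{t-1}+\delta\,(y_t-\langle\mathbf w_{t-1},\mathbf x_t\rangle)\,\mathbf x_t,\qquad \overline{\mathbf w}_0=\mathbf w_0,\quad \overline{\mathbf w}_t=\alpha\overline{\mathbf w}_{t-1}+(1-\alpha)\mathbf w_{t-1}.$$ Suppose $\delta\le1/\lambda_1$, $\alpha^{N-1}\le1/N$ and $N\ge2$. Put $$k^*=\max\{i:\lambda_i\ge(1-\alpha)/\delta\},\qquad k^\dagger=\max\{i:\lambda_i\ge1/(N\delta)\}\qquad(\max\emptyset=0),$$ $$\mathrm{EffectiveBias}=\sum_{i=1}^d(\mathbf w_0-\mathbf w_*)_i^2\,\lambda_i\,b_i^2,\qquad b_i=\frac{\delta\lambda_i\,\alpha^N-(1-\alpha)(1-\delta\lambda_i)^N}{\delta\lambda_i-(1-\alpha)},$$ where $b_i$ is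 read as its limit $\alpha^N+N(1-\alpha)\alpha^{N-1}$ if $\delta\lambda_i=1-\alpha$, and $\|\mathbf v\|^2_{\mathbf H_{k^\dagger:\infty}}=\sum_{i>k^\dagger}\lambda_i v_i^2$. Then $L(\overline{\mathbf w}_N)$ is integrable and $$\mathbb E[L(\overline{\mathbf w}_N)]-L(\mathbf w_*)=\tfrac12\big(\mathrm{EffectiveBias}+\mathrm{EffectiveVar}\big),$$ where the number $\mathrm{EffectiveVar}$ determined by this identity satisfies $$\mathrm{EffectiveVar}\ge\frac{\beta e^{-2}\|\mathbf w_0-\mathbf w_*\|^2_{\mathbf H_{k^\dagger:\infty}}+\sigma^2}{2}\left[\frac{3\alpha^2(1-\alpha)k^*}{16}+\frac{\delta}{100}\sum_{i=k^*+1}^{k^\dagger}\lambda_i+\frac{N\delta^2}{180}\sum_{i>k^\dagger}\lambda_i^2\right].$$ -/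

import Mathlib

open MeasureTheory ProbabilityTheory
open scoped InnerProductSpace

noncomputable section

namespace EMARegression

/-- The coordinate indices `1, 2, …, d`, where the dimension `d` is a natural number or `∞`. -/
abbrev Idx (d : ℕ∞) : Type := {i : ℕ // 1 ≤ i ∧ (i : ℕ∞) ≤ d}

/-- The first coordinate index. -/
abbrev Idx.first {d : ℕ∞} (hd : ((1 : ℕ) : ℕ∞) ≤ d) : Idx d := ⟨1, le_rfl, hd⟩

section Model

variable {E : Type*} [NormedAddCommGroup E] [InnerProductSpace ℝ E] [CompleteSpace E]
  [MeasurableSpace E]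

/-- The risk `L(w) = 1/2 · 𝔼[(y - ⟨w, x⟩)²]` for `(x, y) ∼ D`. -/
def risk (D : Measure (E × ℝ)) (w : E) : ℝ :=
  1 / 2 * ∫ z, (z.2 - ⟪w, z.1⟫_ℝ) ^ 2 ∂D

/-- The label noise `ξ = y - ⟨w_*, x⟩` of the data point `(x, y)`. -/
def noise (wstar : E) (z : E × ℝ) : ℝ := z.2 - ⟪wstar, z.1⟫_ℝ

/-- The covariance operator `H = 𝔼[x xᵀ]`. -/
def cov (D : Measure (E × ℝ)) : E →L[ℝ] E :=
  ∫ z, InnerProductSpace.rankOne ℝ z.1 z.1 ∂D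

/-- The trace of an operator, computed in the orthonormal basis `b`. -/
def tr {ι : Type*} (b : HilbertBasis ι ℝ E) (T : E →L[ℝ] E) : ℝ :=
  ∑' i, ⟪b i, T (b i)⟫_ℝ

/-- The quadratic form `v ↦ vᵀ (M ∘ A) v` of `M ∘ A = 𝔼[x xᵀ A x xᵀ]`. -/
def fourthForm (D : Measure (E × ℝ)) (A : E →L[ℝ] E) (v : E) : ℝ :=
  ∫ z, ⟪v, z.1⟫_ℝ ^ 2 * ⟪z.1, A z.1⟫_ℝ ∂D

/-- Second-order moment assumption: `H` exists and is finite, it is diagonal in the basis `b` with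
eigenvalues `lam` in descending order, it has finite trace, and it is positive definite. -/
structure SecondMoment {d : ℕ∞} (D : Measure (E × ℝ)) (b : HilbertBasis (Idx d) ℝ E)
    (lam : Idx d → ℝ) : Prop where
  integrable : Integrable (fun z : E × ℝ => ‖z.1‖ ^ 2) D
  diagonal : ∀ i, cov D (b i) = lam i • b i
  antitone : Antitone lam
  summable : Summable lam
  pos : ∀ i, 0 < lam i

/-- Fourth moment assumption, lower bound, with constant `β`. The first two fields say that the
fourth moment operator exists and is finite: `M ∘ I`, hence `M ∘ A` for every bounded `A`, is a
well-defined bounded operator (this holds as soon as `𝔼‖x‖⁴ < ∞`). The last field is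
`M ∘ A - H A H ⪰ β tr(H A) H` for every bounded positive semidefinite `A`. -/
structure FourthMomentLower {d : ℕ∞} (D : Measure (E × ℝ)) (b : HilbertBasis (Idx d) ℝ E)
    (β : ℝ) : Prop where
  integrable : ∀ v : E, Integrable (fun z : E × ℝ => ⟪v, z.1⟫_ℝ ^ 2 * ‖z.1‖ ^ 2) D
  finite : ∃ C : ℝ, ∀ v : E, ∫ z, ⟪v, z.1⟫_ℝ ^ 2 * ‖z.1‖ ^ 2 ∂D ≤ C * ‖v‖ ^ 2
  pos : 0 < β
  lower : ∀ A : E →L[ℝ] E, A.IsPositive → ∀ v : E,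
    β * tr b (cov D ∘L A) * ⟪v, cov D v⟫_ℝ ≤
      fourthForm D A v - ⟪v, (cov D ∘L A ∘L cov D) v⟫_ℝ

/-- Well-specified noise: `ξ` is independent of `x`, has mean zero, and `𝔼[ξ²] = σ²`. -/
structure WellSpecified (D : Measure (E × ℝ)) (wstar : E) (σ : ℝ) : Prop where
  indep : IndepFun (noise wstar) Prod.fst D
  memLp : MemLp (noise wstar) 2 D
  mean : ∫ z, noise wstar z ∂D = 0
  second : ∫ z, noise wstar z ^ 2 ∂D = σ ^ 2

/-- The SGD iterates `w_0, w_1, …` with learning rate `δ`; `z t` is the sample `(x, y)` observed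
at iteration `t + 1`. -/
def sgd (δ : ℝ) (w0 : E) (z : ℕ → E × ℝ) : ℕ → E
  | 0 => w0
  | t + 1 => sgd δ w0 z t + (δ * ((z t).2 - ⟪sgd δ w0 z t, (z t).1⟫_ℝ)) • (z t).1

/-- The exponential moving average of the SGD iterates with averaging parameter `α`. -/
def ema (δ α : ℝ) (w0 : E) (z : ℕ → E × ℝ) : ℕ → E
  | 0 => w0
  | t + 1 => α • ema δ α w0 z t + (1 - α) • sgd δ w0 z t

end Model

section Bounds

variable {d : ℕ∞}

/-- `max {i : lam i ≥ c}`, which is `0` if there is no such index. -/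
def cutoff (lam : Idx d → ℝ) (c : ℝ) : ℕ :=
  sSup {k : ℕ | ∃ i : Idx d, (i : ℕ) = k ∧ c ≤ lam i}

/-- `k^* = max {i : lam i ≥ (1 - α) / δ}`. -/
def kStar (lam : Idx d → ℝ) (δ α : ℝ) : ℕ := cutoff lam ((1 - α) / δ)

/-- `k^† = max {i : lam i ≥ 1 / (N δ)}`. -/
def kDagger (lam : Idx d → ℝ) (δ : ℝ) (N : ℕ) : ℕ := cutoff lam (1 / (N * δ))

/-- The decay rate of the bias in the eigendirection with eigenvalue `l`. At `δ l = 1 - α` the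
quotient is read as its limit. -/
def decay (δ α : ℝ) (N : ℕ) (l : ℝ) : ℝ :=
  if δ * l = 1 - α then α ^ N + N * (1 - α) * α ^ (N - 1)
  else (δ * l * α ^ N - (1 - α) * (1 - δ * l) ^ N) / (δ * l - (1 - α))

/-- `∑ i, (u i)² (lam i) (b_i)²`, where `u i` are the coordinates of `w_0 - w_*`. -/
def effectiveBias (lam u : Idx d → ℝ) (δ α : ℝ) (N : ℕ) : ℝ :=
  ∑' i, u i ^ 2 * lam i * decay δ α N (lam i) ^ 2

/-- The squared seminorm of the vector with coordinates `u` given by `H` restricted to the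
coordinates beyond `k`. -/
def tailNormSq (lam u : Idx d → ℝ) (k : ℕ) : ℝ :=
  ∑' i : Idx d, if k < (i : ℕ) then lam i * u i ^ 2 else 0

/-- The bracket in the lower bound of the effective variance. -/
def varBracket (lam : Idx d → ℝ) (δ α : ℝ) (N : ℕ) : ℝ :=
  3 * α ^ 2 * (1 - α) * (kStar lam δ α : ℝ) / 16
    + δ / 100 * (∑' i : Idx d,
        if kStar lam δ α < (i : ℕ) ∧ (i : ℕ) ≤ kDagger lam δ N then lam i else 0)
    + N * δ ^ 2 / 180 * (∑' i : Idx d, if kDagger lam δ N < (i : ℕ) then lam i ^ 2 else 0)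

end Bounds

end EMARegression

end

/-!
Write `η_t = w_t - w_*` for the error of SGD and `η̄_t` for that of its moving average. Since the
noise is centred and independent of `x`, the excess risk of `η̄_N` is half of `⟨η̄_N, H η̄_N⟩`, which
is `∑ λ_i (η̄_N)_i²`; it suffices to bound the second moment of every coordinate from below and to
sum.

*One step.* Given the past, `η_{t+1} = (I - δ H) η_t + δ m` with a centred `m`, and the lower bound
on the fourth moment operator at the rank one operator `A = η_t η_tᵀ` gives
`𝔼[m_i²] ≥ λ_i (σ² + β ⟨η_t, H η_t⟩)` (`le_integral_step_sq`).

*Unrolling.* The new sample is independent of the past, so this integrates to a recursion for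
`𝔼[(A η̄_t + B η_t)_i²]`, in which passing from `t + 1` to `t` changes only the coefficients `A`, `B`
(`comboSq_succ`). Run down to `t = 0`, it bounds the second moment by the squared mean, which for
`η̄_N` is the summand of the effective bias (`decay_eq`), plus the variances injected by the steps,
weighted with the squares of `(1 - α) h_n` for `h_n = ∑_{s<n} (1 - δ λ_i)^s α^(n-1-s)`
(`le_comboSq`, `emaWeight`). Moreover `𝔼⟨η_t, H η_t⟩` is at least `e⁻²` times the tail norm of the
initial error, as beyond `k^†` a step multiplies the mean by more than `1 - 1 / N`
(`tailNormSq_le_sgdExcess`).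

*The weights.* With `q = δ λ_i`, what remains is to bound `q² (1 - α)² ∑_{n<N} h_n²` from below in the
three ranges `q ≥ 1 - α`, `1 / N ≤ q < 1 - α` and `q < 1 / N`, which the cutoffs `k^*` and `k^†`
separate (`varTerm_le`). In the first range the sum is computed in closed form
(`sum_emaWeight_sq`), and `α^(N-1) ≤ 1 / N` bounds what it misses of the infinite series. In the
other two, `(1 - α) h_{n+1} ≥ (1 - q)^n (1 - α^(n+1))`, where `(1 - q)^n ≥ e⁻¹` as long as
`(n + 1) q ≤ 1`.
-/

noncomputable section

namespace EMARegression

/-! ### Weights of the moving average -/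

/-- The weight `∑_{s<n} r^s α^(n-1-s)`: up to the factor `1 - α`, a perturbation of an iterate
which contracts at rate `r` enters the moving average `n` steps later with this weight. -/
def emaWeight (α r : ℝ) (n : ℕ) : ℝ := ∑ s ∈ Finset.range n, r ^ s * α ^ (n - 1 - s)

@[simp] lemma emaWeight_zero (α r : ℝ) : emaWeight α r 0 = 0 := by simp [emaWeight]

@[simp] lemma emaWeight_one (α r : ℝ) : emaWeight α r 1 = 1 := by simp [emaWeight]

lemma emaWeight_succ (α r : ℝ) (n : ℕ) :
    emaWeight α r (n + 1) = α * emaWeight α r n + r ^ n := by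
  have := geom_sum₂_succ_eq (R := ℝ) r α (n := n)
  simp only [emaWeight, Nat.add_sub_cancel]
  rw [this]; ring

lemma emaWeight_mul_sub (α r : ℝ) (n : ℕ) : emaWeight α r n * (r - α) = r ^ n - α ^ n :=
  Commute.geom_sum₂_mul (Commute.all r α) n

lemma emaWeight_self (α : ℝ) (n : ℕ) : emaWeight α α n = n * α ^ (n - 1) :=
  geom_sum₂_self α n

lemma emaWeight_nonneg {α r : ℝ} (hα : 0 ≤ α) (hr : 0 ≤ r) (n : ℕ) : 0 ≤ emaWeight α r n :=
  Finset.sum_nonneg fun _ _ => by positivity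

lemma emaWeight_le {α r : ℝ} (hr : 0 ≤ r) (h : r ≤ α) (n : ℕ) :
    emaWeight α r n ≤ n * α ^ (n - 1) := by
  rw [← emaWeight_self]
  have hα := hr.trans h
  exact Finset.sum_le_sum fun _ _ => by gcongr

/-- Shrinking every factor `r ^ s` of the weight to the smallest one, `r ^ n`, leaves a geometric sum
in `α`. The bound loses only a constant factor where it is used, for `α ≤ r`. -/
lemma pow_mul_one_sub_pow_le {α r : ℝ} (hα : 0 ≤ α) (hα1 : α ≤ 1) (hr : 0 ≤ r) (hr1 : r ≤ 1)
    (n : ℕ) : r ^ n * (1 - α ^ (n + 1)) ≤ (1 - α) * emaWeight α r (n + 1) := by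
  induction n with
  | zero => simp
  | succ n ih =>
    rw [emaWeight_succ]
    have h1 : r ^ (n + 1) * (1 - α ^ (n + 1)) ≤ r ^ n * (1 - α ^ (n + 1)) := by
      have : 0 ≤ 1 - α ^ (n + 1) := sub_nonneg.2 (pow_le_one₀ hα hα1)
      exact mul_le_mul_of_nonneg_right (pow_le_pow_of_le_one hr hr1 (Nat.le_succ n)) this
    have h2 := mul_le_mul_of_nonneg_left (h1.trans ih) hα
    calc r ^ (n + 1) * (1 - α ^ (n + 1 + 1))
        = α * (r ^ (n + 1) * (1 - α ^ (n + 1))) + (1 - α) * r ^ (n + 1) := by ring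
      _ ≤ α * ((1 - α) * emaWeight α r (n + 1)) + (1 - α) * r ^ (n + 1) := by gcongr
      _ = _ := by ring

/-- The sum of the squared weights in closed form: the quadratic form with coefficients `A`, `B`,
`C`, evaluated at the state `(emaWeight α r n, r ^ n)`, drops by `emaWeight α r n ^ 2` at every
step. -/
lemma sum_emaWeight_sq {α r A B C : ℝ} (hA : A * (1 - α ^ 2) = 1) (hB : B * (1 - α * r) = A * α)
    (hC : C * (1 - r ^ 2) = A + 2 * B * r) (N : ℕ) :
    ∑ n ∈ Finset.range N, emaWeight α r n ^ 2 =
      C - A * emaWeight α r N ^ 2 - 2 * B * emaWeight α r N * r ^ N - C * (r ^ N) ^ 2 := by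
  induction N with
  | zero => simp
  | succ N ih =>
    rw [Finset.sum_range_succ, ih, emaWeight_succ, pow_succ r N]
    linear_combination (-(emaWeight α r N ^ 2)) * hA + (-2 * emaWeight α r N * r ^ N) * hB
      - (r ^ N) ^ 2 * hC

/-! ### Lower bounds for the squared weights -/

lemma exp_neg_one_le_pow {q : ℝ} {m : ℕ} (h : (m + 1) * q ≤ 1) :
    Real.exp (-1) ≤ (1 - q) ^ m := by
  rcases Nat.eq_zero_or_pos m with rfl | hm
  · simp
  have hm' : (0 : ℝ) < m := by exact_mod_cast hm
  have h1 : Real.exp (-(1 / m : ℝ)) ≤ 1 - q := by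
    rw [Real.exp_neg]
    have h2 : 1 / (m : ℝ) + 1 ≤ Real.exp (1 / m) := Real.add_one_le_exp _
    calc (Real.exp (1 / m : ℝ))⁻¹ ≤ (1 / (m : ℝ) + 1)⁻¹ := inv_anti₀ (by positivity) h2
      _ = m / (m + 1) := by field_simp; ring
      _ ≤ 1 - q := by
        rw [div_le_iff₀ (by positivity)]; nlinarith
  calc Real.exp (-1) = Real.exp (-(1 / m : ℝ)) ^ m := by
        rw [← Real.exp_nat_mul]; congr 1; field_simp
    _ ≤ (1 - q) ^ m := by gcongr

lemma two_fifteenths_lt_exp_neg_one_sq : (2 : ℝ) / 15 < Real.exp (-1) ^ 2 := by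
  have := Real.exp_neg_one_gt_d9
  nlinarith

lemma cube_le_three_mul_sum_sq (K : ℕ) :
    (K : ℝ) ^ 3 ≤ 3 * ∑ n ∈ Finset.range K, ((n : ℝ) + 1) ^ 2 := by
  induction K with
  | zero => simp
  | succ K ih =>
    rw [Finset.sum_range_succ]
    push_cast
    have : (0 : ℝ) ≤ K := K.cast_nonneg
    nlinarith

lemma sum_emaWeight_sq_eq_succ (α r : ℝ) {N : ℕ} (hN : 2 ≤ N) :
    ∑ n ∈ Finset.range N, emaWeight α r n ^ 2 =
      ∑ n ∈ Finset.range (N - 1), emaWeight α r (n + 1) ^ 2 := by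
  obtain ⟨M, rfl⟩ : ∃ M, N = M + 1 := ⟨N - 1, by omega⟩
  rw [Finset.sum_range_succ']; simp

lemma one_le_sum_emaWeight_sq (α r : ℝ) {N : ℕ} (hN : 2 ≤ N) :
    1 ≤ ∑ n ∈ Finset.range N, emaWeight α r n ^ 2 := by
  have := Finset.single_le_sum (f := fun n => emaWeight α r n ^ 2) (fun _ _ => sq_nonneg _)
    (Finset.mem_range.2 (show 1 < N by omega))
  simpa using this

/-- The moving average forgets its past within the horizon: Bernoulli's inequality. -/
lemma one_div_le_one_sub {α : ℝ} {N : ℕ} (hα0 : 0 < α) (hN : 2 ≤ N)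
    (hαN : α ^ (N - 1) ≤ 1 / (N : ℝ)) : 1 / (N : ℝ) ≤ 1 - α := by
  obtain ⟨M, rfl⟩ : ∃ M, N = M + 1 := ⟨N - 1, by omega⟩
  have hM : (1 : ℝ) ≤ M := by exact_mod_cast (by omega : 1 ≤ M)
  have hB := one_add_mul_le_pow (a := α - 1) (by linarith) M
  simp only [Nat.add_sub_cancel, add_sub_cancel] at hαN hB
  have h1 := hB.trans hαN
  push_cast at h1 ⊢
  rw [div_le_iff₀ (by positivity)]
  rw [le_div_iff₀ (by positivity)] at h1
  have : (M : ℝ) * ((1 - α) * (M + 1) - 1) ≥ 0 := by nlinarith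
  nlinarith [nonneg_of_mul_nonneg_right this (by linarith)]

lemma weights_polynomial_bound {α : ℝ} (h : 13 / 20 ≤ α) (h1 : α ≤ 1) :
    3 * α ^ 2 / 32 ≤ 1 / 4 * (1 - (α / 5) ^ 2) - 1 / (1 + α) * (1 - 4 / 5 * α) ^ 2
      - 2 * (α / (1 + α)) * (1 - 4 / 5 * α) * (α / 5) := by
  have hα : 0 < 1 + α := by linarith
  have key : 1 / 4 * (1 - (α / 5) ^ 2) - 1 / (1 + α) * (1 - 4 / 5 * α) ^ 2
      - 2 * (α / (1 + α)) * (1 - 4 / 5 * α) * (α / 5) = (1 / 4 * (1 - (α / 5) ^ 2) * (1 + α)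
        - (1 - 4 / 5 * α) ^ 2 - 2 * α * (1 - 4 / 5 * α) * (α / 5)) / (1 + α) := by
    field_simp
  rw [key, le_div_iff₀ hα]
  obtain ⟨s, rfl⟩ : ∃ s, α = 13 / 20 + s := ⟨α - 13 / 20, by ring⟩
  have hs : 0 ≤ s := by linarith
  have hs' : s ^ 2 ≤ 7 / 20 * s := by nlinarith
  nlinarith [pow_nonneg hs 3]

set_option maxHeartbeats 400000 in
/-- The range `q ≥ 1 - α`. The infinite series exceeds the required bound by a constant factor, and
for `N ≥ 5` the part beyond `N` uses up less than the difference. -/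
lemma weights_bound_of_le {α q : ℝ} {N : ℕ} (hα0 : 0 < α) (hα1 : α < 1) (hq1 : q ≤ 1)
    (hN : 2 ≤ N) (hαN : α ^ (N - 1) ≤ 1 / (N : ℝ)) (hq : 1 - α ≤ q) :
    3 * α ^ 2 * (1 - α) / 32 ≤
      q ^ 2 * (1 - α) ^ 2 * ∑ n ∈ Finset.range N, emaWeight α (1 - q) n ^ 2 := by
  have hp : 0 < 1 - α := by linarith
  have hq0 : 0 < q := by linarith
  rcases le_or_gt α (13 / 20) with hα | hα
  · -- here the single weight `emaWeight α (1 - q) 1 = 1` is enough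
    have h1 := one_le_sum_emaWeight_sq α (1 - q) hN
    have h2 : (1 - α) ^ 2 ≤ q ^ 2 := by gcongr
    calc 3 * α ^ 2 * (1 - α) / 32 ≤ (1 - α) ^ 2 * (1 - α) ^ 2 * 1 := by
          have : 3 * α ^ 2 / 32 ≤ (1 - α) ^ 3 := by
            have h3 : (7 / 20 : ℝ) ^ 3 ≤ (1 - α) ^ 3 := by gcongr; linarith
            nlinarith
          nlinarith
      _ ≤ _ := by gcongr
  -- otherwise `α ^ (N - 1) ≤ 1 / N` excludes `N ≤ 4`
  have hN5 : 5 ≤ N := by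
    by_contra hcon
    have h3 : N = 2 ∨ N = 3 ∨ N = 4 := by omega
    rcases h3 with rfl | rfl | rfl <;> norm_num at hαN <;> nlinarith [pow_pos hα0 2]
  have hN5' : (5 : ℝ) ≤ N := by exact_mod_cast hN5
  have hN0 : (0 : ℝ) < N := by linarith
  set r := 1 - q with hr
  have hr0 : 0 ≤ r := by linarith
  have hrα : r ≤ α := by linarith
  have hr1 : r < 1 := by linarith
  have hαr : α * r < 1 := mul_lt_one_of_nonneg_of_lt_one_left hα0.le hα1 hr1.le
  set h := emaWeight α r N with hh
  have hh0 : 0 ≤ h := emaWeight_nonneg hα0.le hr0 N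
  have hαN' : α ^ N ≤ α / 5 := by
    have : α ^ N = α * α ^ (N - 1) := by rw [← pow_succ']; congr 1; omega
    rw [this, div_eq_mul_one_div]
    refine mul_le_mul_of_nonneg_left (hαN.trans ?_) hα0.le
    exact one_div_le_one_div_of_le (by norm_num) hN5'
  have hrN : r ^ N ≤ α / 5 := (pow_le_pow_left₀ hr0 hrα N).trans hαN'
  have hrN0 : 0 ≤ r ^ N := by positivity
  have hle1 : h ≤ 1 := by
    refine (emaWeight_le hr0 hrα N).trans ?_
    calc (N : ℝ) * α ^ (N - 1) ≤ N * (1 / N) := by gcongr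
      _ = 1 := by field_simp
  set x := q * h with hx
  have hx0 : 0 ≤ x := by positivity
  -- `q h_N = (α ^ N - r ^ N) + (1 - α) h_N`
  have hx1 : x ≤ 1 - 4 / 5 * α := by
    have h1 := emaWeight_mul_sub α r N
    have h2 : x = α ^ N - r ^ N + (1 - α) * h := by
      rw [hx]; rw [← hh] at h1; linear_combination -h1 - h * hr
    have h3 : (1 - α) * h ≤ 1 - α := mul_le_of_le_one_right hp.le hle1
    linarith
  have e1 : 1 - α ^ 2 ≠ 0 := (sub_pos.2 (pow_lt_one₀ hα0.le hα1 two_ne_zero)).ne'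
  have e2 : 1 - α * r ≠ 0 := by linarith
  have e3 : 1 - r ^ 2 ≠ 0 := (sub_pos.2 (pow_lt_one₀ hr0 hr1 two_ne_zero)).ne'
  set A := 1 / (1 - α ^ 2) with hA
  set B := A * α / (1 - α * r) with hB
  set C := (A + 2 * B * r) / (1 - r ^ 2) with hC
  rw [sum_emaWeight_sq (A := A) (B := B) (C := C) (by rw [hA]; field_simp)
    (by rw [hB]; field_simp) (by rw [hC]; field_simp) N, ← hh]
  have hα' : 1 + α ≠ 0 := by linarith
  have hpA : (1 - α) * A = 1 / (1 + α) := by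
    rw [hA, eq_div_iff hα']; field_simp; ring
  -- the factor `q` is absorbed by `q ≤ 1 - α r`
  have hpB : q * ((1 - α) * B) ≤ α / (1 + α) := by
    have : q * ((1 - α) * B) = (q / (1 - α * r)) * (α / (1 + α)) := by
      rw [hB, show (1 - α) * (A * α / (1 - α * r)) = ((1 - α) * A) * α / (1 - α * r) by ring, hpA]
      ring
    rw [this]
    refine mul_le_of_le_one_left (by positivity) ?_
    rw [div_le_one (by linarith)]
    nlinarith
  have hpC : 1 / 4 ≤ q ^ 2 * (1 - α) * C := by
    have h1 : (1 - α) * C * (q * (1 + r)) * ((1 + α) * (1 - α * r)) = 1 + α * r := by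
      have e4 : q * (1 + r) = 1 - r ^ 2 := by rw [hr]; ring
      rw [e4, hC, show (1 - α) * ((A + 2 * B * r) / (1 - r ^ 2)) * (1 - r ^ 2)
        = (1 - α) * A + 2 * ((1 - α) * B) * r by field_simp, hB,
        show (1 - α) * (A * α / (1 - α * r)) = ((1 - α) * A) * α / (1 - α * r) by ring, hpA]
      field_simp; ring
    have hden : 0 < (1 + r) * ((1 + α) * (1 - α * r)) := by
      have : 0 < 1 - α * r := by linarith
      positivity
    have hY : q ^ 2 * (1 - α) * C = q * (1 + α * r) / ((1 + r) * ((1 + α) * (1 - α * r))) := by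
      rw [eq_div_iff hden.ne', ← h1]; ring
    rw [hY, div_le_div_iff₀ (by norm_num) hden]
    -- `1 - α r ≤ 2 q` and `(1 + α) (1 + r) ≤ 2 (1 + α r)`
    have a1 : 1 - α * r ≤ 2 * q := by nlinarith
    have a2 : (1 + r) * (1 + α) ≤ 2 * (1 + α * r) := by nlinarith
    have a3 : (1 + r) * (1 + α) * (1 - α * r) ≤ (2 * (1 + α * r)) * (2 * q) := by
      apply mul_le_mul a2 a1 (by linarith) (by positivity)
    linarith
  have key : q ^ 2 * (1 - α) ^ 2 * (C - A * h ^ 2 - 2 * B * h * r ^ N - C * (r ^ N) ^ 2)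
      = (1 - α) * (q ^ 2 * (1 - α) * C * (1 - (r ^ N) ^ 2) - (1 - α) * A * x ^ 2
        - 2 * (q * ((1 - α) * B)) * x * r ^ N) := by
    rw [hx]; ring
  rw [key]
  have t1 : 1 / 4 * (1 - (α / 5) ^ 2) ≤ q ^ 2 * (1 - α) * C * (1 - (r ^ N) ^ 2) := by
    have : (r ^ N) ^ 2 ≤ (α / 5) ^ 2 := by gcongr
    have h5 : (α / 5) ^ 2 ≤ 1 := pow_le_one₀ (by positivity) (by linarith)
    exact mul_le_mul hpC (by linarith) (by linarith) (by linarith)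
  have t2 : (1 - α) * A * x ^ 2 ≤ 1 / (1 + α) * (1 - 4 / 5 * α) ^ 2 := by
    rw [hpA]; gcongr
  have t3 : 2 * (q * ((1 - α) * B)) * x * r ^ N ≤
      2 * (α / (1 + α)) * (1 - 4 / 5 * α) * (α / 5) := by
    have : 0 ≤ 1 - 4 / 5 * α := by linarith
    gcongr
  have t4 := weights_polynomial_bound hα.le hα1.le
  have t5 : 3 * α ^ 2 / 32 ≤ q ^ 2 * (1 - α) * C * (1 - (r ^ N) ^ 2) - (1 - α) * A * x ^ 2
        - 2 * (q * ((1 - α) * B)) * x * r ^ N := by linarith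
  calc 3 * α ^ 2 * (1 - α) / 32 = (1 - α) * (3 * α ^ 2 / 32) := by ring
    _ ≤ _ := mul_le_mul_of_nonneg_left t5 hp.le

/-- The averages `(1 - α ^ n) / n` decrease in `n`, since `n ↦ α ^ n` is convex. -/
lemma nat_mul_one_sub_pow_le {α : ℝ} (hα0 : 0 ≤ α) (hα1 : α ≤ 1) {n M : ℕ} (h : n ≤ M) :
    n * (1 - α ^ M) ≤ M * (1 - α ^ n) := by
  induction M, h using Nat.le_induction with
  | base => rfl
  | succ M hM ih =>
    have h1 : α ^ M ≤ α ^ n := pow_le_pow_of_le_one hα0 hα1 hM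
    have h2 : (n : ℝ) * α ^ M * (1 - α) ≤ 1 - α ^ n := by
      have h3 : (n : ℝ) * (α ^ n * (1 - α)) ≤ 1 - α ^ n := by
        rw [← mul_neg_geom_sum α n, mul_comm (1 - α), ← mul_assoc]
        refine mul_le_mul_of_nonneg_right ?_ (by linarith)
        rw [← nsmul_eq_mul]
        calc n • α ^ n = ∑ i ∈ Finset.range n, α ^ n := by simp
          _ ≤ _ := Finset.sum_le_sum fun i hi =>
            pow_le_pow_of_le_one hα0 hα1 (Finset.mem_range.1 hi).le
      refine le_trans ?_ h3
      rw [mul_assoc]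
      gcongr
    push_cast
    rw [pow_succ]
    nlinarith

/-- The range `q ≤ 1 / N`: here `(1 - q) ^ n ≥ e⁻¹` for all `n < N`, and `α ^ (N - 1) ≤ 1 / 2` makes
`1 - α ^ n` at least of order `n / N`. -/
lemma weights_bound_of_lt {α q : ℝ} {N : ℕ} (hα0 : 0 < α) (hα1 : α < 1) (hq0 : 0 < q)
    (hN : 2 ≤ N) (hαN : α ^ (N - 1) ≤ 1 / (N : ℝ)) (hq : q ≤ 1 / N) :
    N * q ^ 2 / 360 ≤
      q ^ 2 * (1 - α) ^ 2 * ∑ n ∈ Finset.range N, emaWeight α (1 - q) n ^ 2 := by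
  rw [sum_emaWeight_sq_eq_succ _ _ hN]
  obtain ⟨M, rfl⟩ : ∃ M, N = M + 1 := ⟨N - 1, by omega⟩
  simp only [Nat.add_sub_cancel] at *
  have hM : (1 : ℝ) ≤ M := by exact_mod_cast (by omega : 1 ≤ M)
  push_cast at *
  have hq' : q * (M + 1) ≤ 1 := by rwa [le_div_iff₀ (by linarith)] at hq
  have hα2 : α ^ M ≤ 1 / 2 := hαN.trans (one_div_le_one_div_of_le (by norm_num) (by linarith))
  have hterm : ∀ n ∈ Finset.range M, 2 / 15 * (1 / (4 * M ^ 2)) * ((n : ℝ) + 1) ^ 2 ≤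
      (1 - α) ^ 2 * emaWeight α (1 - q) (n + 1) ^ 2 := by
    intro n hn
    have hnM : n + 1 ≤ M := Finset.mem_range.1 hn
    have hnM' : (n : ℝ) + 1 ≤ M := by exact_mod_cast hnM
    have h1 := pow_mul_one_sub_pow_le hα0.le hα1.le (by nlinarith : 0 ≤ 1 - q) (by linarith) n
    have h2 := nat_mul_one_sub_pow_le hα0.le hα1.le hnM
    push_cast at h2
    have h3 : ((n : ℝ) + 1) / (2 * M) ≤ 1 - α ^ (n + 1) := by
      rw [div_le_iff₀ (by linarith)]
      nlinarith
    have h4 : Real.exp (-1) ≤ (1 - q) ^ n := exp_neg_one_le_pow (by nlinarith)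
    have h5 : Real.exp (-1) * (((n : ℝ) + 1) / (2 * M)) ≤ (1 - α) * emaWeight α (1 - q) (n + 1) :=
      le_trans (by gcongr; exact (Real.exp_pos _).le.trans h4) h1
    calc 2 / 15 * (1 / (4 * M ^ 2)) * ((n : ℝ) + 1) ^ 2
        = 2 / 15 * (((n : ℝ) + 1) / (2 * M)) ^ 2 := by field_simp; norm_num
      _ ≤ Real.exp (-1) ^ 2 * (((n : ℝ) + 1) / (2 * M)) ^ 2 := by
        gcongr; exact two_fifteenths_lt_exp_neg_one_sq.le
      _ = (Real.exp (-1) * (((n : ℝ) + 1) / (2 * M))) ^ 2 := by ring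
      _ ≤ ((1 - α) * emaWeight α (1 - q) (n + 1)) ^ 2 := by gcongr
      _ = _ := by ring
  have hsum := Finset.sum_le_sum hterm
  rw [← Finset.mul_sum, ← Finset.mul_sum] at hsum
  have hc := cube_le_three_mul_sum_sq M
  have : ((M : ℝ) + 1) / 360 ≤ 2 / 15 * (1 / (4 * M ^ 2)) *
      ∑ i ∈ Finset.range M, ((i : ℝ) + 1) ^ 2 := by
    calc ((M : ℝ) + 1) / 360 ≤ 2 / 15 * (1 / (4 * M ^ 2)) * (M ^ 3 / 3) := by
          have : 2 / 15 * (1 / (4 * (M : ℝ) ^ 2)) * (M ^ 3 / 3) = M / 90 := by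
            field_simp; norm_num
          rw [this]; linarith
      _ ≤ _ := by gcongr; linarith
  calc ((M : ℝ) + 1) * q ^ 2 / 360 = q ^ 2 * (((M : ℝ) + 1) / 360) := by ring
    _ ≤ q ^ 2 * ((1 - α) ^ 2 * ∑ i ∈ Finset.range M, emaWeight α (1 - q) (i + 1) ^ 2) := by
      gcongr; linarith
    _ = _ := by ring

/-- For `n q ≤ 1` Bernoulli's inequality can be reversed up to a factor `1 / 2`. -/
lemma half_mul_le_one_sub_pow {q : ℝ} (hq0 : 0 ≤ q) (hq1 : q ≤ 1) {n : ℕ} (h : n * q ≤ 1) :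
    n * q / 2 ≤ 1 - (1 - q) ^ n := by
  have key : ∀ m : ℕ, m ≤ n → (1 - q) ^ m ≤ 1 - m * q / 2 := by
    intro m
    induction m with
    | zero => simp
    | succ m ih =>
      intro hm
      have h1 := ih (by omega)
      have h2 : (m : ℝ) * q ≤ 1 := le_trans (by gcongr; omega) h
      rw [pow_succ]; push_cast
      have h3 := mul_le_mul_of_nonneg_right h1 (by linarith : 0 ≤ 1 - q)
      nlinarith [mul_nonneg hq0 (by linarith : 0 ≤ 1 - m * q)]
  linarith [key n le_rfl]

/-- The range `1 / N ≤ q ≤ 1 - α`: the terms with `n q ≤ 1` are enough, all of them being present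
because of `1 / q ≤ N`. -/
lemma weights_bound_of_between {α q : ℝ} {N : ℕ} (hα0 : 0 < α) (hα1 : α < 1) (hN : 2 ≤ N)
    (hq : 1 / N ≤ q) (hqα : q ≤ 1 - α) :
    q / 200 ≤ q ^ 2 * (1 - α) ^ 2 * ∑ n ∈ Finset.range N, emaWeight α (1 - q) n ^ 2 := by
  have hN0 : (0 : ℝ) < N := by exact_mod_cast (by omega : 0 < N)
  have hq0 : 0 < q := lt_of_lt_of_le (by positivity) hq
  rcases le_or_gt (1 / 5) q with h | h
  · -- here the single weight `emaWeight α (1 - q) 1 = 1` is enough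
    have h1 := one_le_sum_emaWeight_sq α (1 - q) hN
    have h3 : (1 / 5 : ℝ) ^ 3 ≤ q ^ 3 := by gcongr
    calc q / 200 ≤ q ^ 2 * q ^ 2 * 1 := by nlinarith
      _ ≤ _ := by gcongr
  -- `K` is the largest integer strictly below `1 / q`
  obtain ⟨K, hK⟩ : ∃ K, K + 1 = ⌈1 / q⌉₊ :=
    ⟨⌈1 / q⌉₊ - 1, by have := Nat.ceil_pos.2 (show 0 < 1 / q by positivity); omega⟩
  have hK1 : (K : ℝ) * q ≤ 1 := by
    have : (K : ℝ) < 1 / q := Nat.lt_ceil.1 (by omega)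
    rw [lt_div_iff₀ hq0] at this; exact this.le
  have hK2 : 1 - q ≤ K * q := by
    have : 1 / q ≤ (K + 1 : ℕ) := hK ▸ Nat.le_ceil _
    rw [div_le_iff₀ hq0] at this; push_cast at this; linarith
  have hKN : K ≤ N - 1 := by
    have : ⌈1 / q⌉₊ ≤ N := Nat.ceil_le.2 (by rwa [one_div_le hq0 hN0])
    omega
  rw [sum_emaWeight_sq_eq_succ _ _ hN]
  have hterm : ∀ n ∈ Finset.range K, 2 / 15 * (q ^ 2 / 4) * ((n : ℝ) + 1) ^ 2 ≤
      (1 - α) ^ 2 * emaWeight α (1 - q) (n + 1) ^ 2 := by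
    intro n hn
    have hnK : n + 1 ≤ K := Finset.mem_range.1 hn
    have hnK' : (n : ℝ) + 1 ≤ K := by exact_mod_cast hnK
    have hnq : ((n : ℝ) + 1) * q ≤ 1 := le_trans (by gcongr) hK1
    have h1 := pow_mul_one_sub_pow_le hα0.le hα1.le (by linarith : 0 ≤ 1 - q) (by linarith) n
    have h2 : ((n + 1 : ℕ) : ℝ) * q / 2 ≤ 1 - (1 - q) ^ (n + 1) :=
      half_mul_le_one_sub_pow hq0.le (by linarith) (by push_cast; exact hnq)
    have h3 : ((n : ℝ) + 1) * q / 2 ≤ 1 - α ^ (n + 1) := by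
      have : α ^ (n + 1) ≤ (1 - q) ^ (n + 1) := by gcongr; linarith
      push_cast at h2; linarith
    have h4 : Real.exp (-1) ≤ (1 - q) ^ n := exp_neg_one_le_pow hnq
    have h5 : Real.exp (-1) * (((n : ℝ) + 1) * q / 2) ≤ (1 - α) * emaWeight α (1 - q) (n + 1) :=
      le_trans (by gcongr; exact (Real.exp_pos _).le.trans h4) h1
    calc 2 / 15 * (q ^ 2 / 4) * ((n : ℝ) + 1) ^ 2
        = 2 / 15 * (((n : ℝ) + 1) * q / 2) ^ 2 := by ring
      _ ≤ Real.exp (-1) ^ 2 * (((n : ℝ) + 1) * q / 2) ^ 2 := by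
        gcongr; exact two_fifteenths_lt_exp_neg_one_sq.le
      _ = (Real.exp (-1) * (((n : ℝ) + 1) * q / 2)) ^ 2 := by ring
      _ ≤ ((1 - α) * emaWeight α (1 - q) (n + 1)) ^ 2 := by gcongr
      _ = _ := by ring
  have hsum := Finset.sum_le_sum hterm
  rw [← Finset.mul_sum, ← Finset.mul_sum] at hsum
  have hsub : ∑ n ∈ Finset.range K, emaWeight α (1 - q) (n + 1) ^ 2 ≤
      ∑ n ∈ Finset.range (N - 1), emaWeight α (1 - q) (n + 1) ^ 2 :=
    Finset.sum_le_sum_of_subset_of_nonneg (Finset.range_mono hKN) fun _ _ _ => sq_nonneg _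
  have hc := cube_le_three_mul_sum_sq K
  have hcube : (4 / 5 : ℝ) ^ 3 ≤ (K * q) ^ 3 := by gcongr; linarith
  have hlow : 1 / (200 * q) ≤ (1 - α) ^ 2 *
      ∑ n ∈ Finset.range (N - 1), emaWeight α (1 - q) (n + 1) ^ 2 := by
    calc 1 / (200 * q) ≤ 2 / 15 * (q ^ 2 / 4) * (K ^ 3 / 3) := by
          rw [div_le_iff₀ (by positivity)]
          have : 2 / 15 * (q ^ 2 / 4) * ((K : ℝ) ^ 3 / 3) * (200 * q)
            = 200 / 90 * (K * q) ^ 3 := by ring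
          rw [this]; norm_num at hcube ⊢; linarith
      _ ≤ 2 / 15 * (q ^ 2 / 4) * ∑ i ∈ Finset.range K, ((i : ℝ) + 1) ^ 2 := by
        gcongr; linarith
      _ ≤ _ := hsum.trans (by gcongr)
  calc q / 200 = q ^ 2 * (1 / (200 * q)) := by field_simp
    _ ≤ q ^ 2 * ((1 - α) ^ 2 * ∑ n ∈ Finset.range (N - 1), emaWeight α (1 - q) (n + 1) ^ 2) := by
      gcongr
    _ = _ := by ring

/-- The mean of the moving average along an eigendirection. -/
lemma decay_eq (δ α : ℝ) (N : ℕ) (l : ℝ) :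
    decay δ α N l = α ^ N + (1 - α) * emaWeight α (1 - δ * l) N := by
  unfold decay
  split_ifs with h
  · rw [h, sub_sub_cancel, emaWeight_self]; ring
  · have h0 : δ * l - (1 - α) ≠ 0 := sub_ne_zero.2 h
    have := emaWeight_mul_sub α (1 - δ * l) N
    rw [div_eq_iff h0]
    linear_combination (1 - α) * this

/-! ### A single sample -/

section OneSample

variable {E : Type*} [NormedAddCommGroup E] [InnerProductSpace ℝ E]
  [SecondCountableTopology E] [MeasurableSpace E] [BorelSpace E]
  {D : Measure (E × ℝ)}

lemma measurable_noise (wstar : E) : Measurable (noise wstar) := by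
  unfold noise; fun_prop

lemma integrable_inner_mul_inner (hD : Integrable (fun z : E × ℝ => ‖z.1‖ ^ 2) D) (v w : E) :
    Integrable (fun z : E × ℝ => ⟪v, z.1⟫_ℝ * ⟪w, z.1⟫_ℝ) D := by
  refine (hD.const_mul (‖v‖ * ‖w‖)).mono' (by fun_prop) (.of_forall fun z => ?_)
  rw [norm_mul]
  calc ‖⟪v, z.1⟫_ℝ‖ * ‖⟪w, z.1⟫_ℝ‖ ≤ (‖v‖ * ‖z.1‖) * (‖w‖ * ‖z.1‖) := by
        gcongr <;> exact norm_inner_le_norm _ _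
    _ = _ := by ring

lemma FourthMomentLower.integrable_sq_mul_sq {d : ℕ∞}
    {b : HilbertBasis (Idx d) ℝ E} {β : ℝ} (h : FourthMomentLower D b β) (v η : E) :
    Integrable (fun z : E × ℝ => ⟪v, z.1⟫_ℝ ^ 2 * ⟪η, z.1⟫_ℝ ^ 2) D := by
  refine ((h.integrable v).const_mul (‖η‖ ^ 2)).mono' (by fun_prop) (.of_forall fun z => ?_)
  rw [norm_mul, norm_pow, norm_pow, Real.norm_eq_abs, sq_abs]
  calc ⟪v, z.1⟫_ℝ ^ 2 * ‖⟪η, z.1⟫_ℝ‖ ^ 2 ≤ ⟪v, z.1⟫_ℝ ^ 2 * (‖η‖ * ‖z.1‖) ^ 2 := by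
        gcongr; exact norm_inner_le_norm _ _
    _ = _ := by ring

lemma WellSpecified.integral_mul {wstar : E} {σ : ℝ} (h : WellSpecified D wstar σ)
    {f : ℝ → ℝ} {g : E → ℝ}
    (hf : Measurable f) (hg : Measurable g) :
    ∫ z, f (noise wstar z) * g z.1 ∂D = (∫ z, f (noise wstar z) ∂D) * ∫ z, g z.1 ∂D :=
  (h.indep.comp hf hg).integral_fun_mul_eq_mul_integral
    (hf.comp (measurable_noise wstar)).aestronglyMeasurable
    (hg.comp measurable_fst).aestronglyMeasurable

variable [CompleteSpace E]

lemma inner_cov (hD : Integrable (fun z : E × ℝ => ‖z.1‖ ^ 2) D) (v w : E) :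
    ⟪v, cov D w⟫_ℝ = ∫ z, ⟪v, z.1⟫_ℝ * ⟪w, z.1⟫_ℝ ∂D := by
  have hint : Integrable (fun z : E × ℝ => InnerProductSpace.rankOne ℝ z.1 z.1) D := by
    refine hD.mono' ?_ (.of_forall fun z => ?_)
    · have hc : Continuous fun x : E => InnerProductSpace.rankOne ℝ x x :=
        (InnerProductSpace.rankOne ℝ (E := E) (F := E)).continuous.clm_apply continuous_id
      exact (hc.stronglyMeasurable.comp_measurable measurable_fst).aestronglyMeasurable
    · simp [sq]
  have hint' := hint.apply_continuousLinearMap w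
  rw [cov, ContinuousLinearMap.integral_apply hint, ← integral_inner hint']
  refine integral_congr_ae (.of_forall fun z => ?_)
  simp [inner_smul_right, real_inner_comm, mul_comm]

lemma cov_symm (hD : Integrable (fun z : E × ℝ => ‖z.1‖ ^ 2) D) (v w : E) :
    ⟪v, cov D w⟫_ℝ = ⟪cov D v, w⟫_ℝ := by
  rw [real_inner_comm _ (cov D v), inner_cov hD, inner_cov hD]
  simp only [mul_comm]

lemma inner_cov_self_nonneg (hD : Integrable (fun z : E × ℝ => ‖z.1‖ ^ 2) D) (v : E) :
    0 ≤ ⟪v, cov D v⟫_ℝ := by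
  rw [inner_cov hD]; exact integral_nonneg fun z => mul_self_nonneg _

section Diagonal

variable {d : ℕ∞} {b : HilbertBasis (Idx d) ℝ E} {lam : Idx d → ℝ}

lemma SecondMoment.inner_basis_cov (h : SecondMoment D b lam) (i : Idx d) (v : E) :
    ⟪b i, cov D v⟫_ℝ = lam i * ⟪b i, v⟫_ℝ := by
  rw [cov_symm h.integrable, h.diagonal, real_inner_smul_left]

lemma SecondMoment.hasSum_inner_cov (h : SecondMoment D b lam) (v : E) :
    HasSum (fun i => lam i * ⟪b i, v⟫_ℝ ^ 2) ⟪v, cov D v⟫_ℝ := by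
  refine (b.hasSum_inner_mul_inner v (cov D v)).congr_fun fun i => ?_
  rw [h.inner_basis_cov, real_inner_comm v]; ring

end Diagonal

section Noise

variable {wstar : E} {σ : ℝ}

/-- The excess risk is half the quadratic form of the covariance. -/
lemma WellSpecified.risk_eq [IsFiniteMeasure D] (h : WellSpecified D wstar σ)
    (hD : Integrable (fun z : E × ℝ => ‖z.1‖ ^ 2) D) (w : E) :
    risk D w = risk D wstar + 1 / 2 * ⟪w - wstar, cov D (w - wstar)⟫_ℝ := by
  have hx : Integrable (fun z : E × ℝ => ⟪w - wstar, z.1⟫_ℝ) D := by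
    have : MemLp (fun z : E × ℝ => ⟪w - wstar, z.1⟫_ℝ) 2 D := by
      rw [memLp_two_iff_integrable_sq (by fun_prop)]
      simpa [sq] using integrable_inner_mul_inner hD (w - wstar) (w - wstar)
    exact this.integrable (by norm_num)
  have hg : Measurable fun x : E => ⟪w - wstar, x⟫_ℝ := by fun_prop
  have h1 : Integrable (fun z => noise wstar z * ⟪w - wstar, z.1⟫_ℝ) D :=
    (h.indep.comp measurable_id hg).integrable_mul (h.memLp.integrable (by norm_num)) hx
  have h2 := h.integral_mul measurable_id hg
  have h3 := integrable_inner_mul_inner hD (w - wstar) (w - wstar)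
  simp only [id] at h2
  rw [h.mean, zero_mul] at h2
  have key : ∀ z : E × ℝ, (z.2 - ⟪w, z.1⟫_ℝ) ^ 2 = noise wstar z ^ 2
      - 2 * (noise wstar z * ⟪w - wstar, z.1⟫_ℝ)
      + ⟪w - wstar, z.1⟫_ℝ * ⟪w - wstar, z.1⟫_ℝ := by
    intro z; simp only [noise, inner_sub_left]; ring
  have h4 : Integrable (fun z => noise wstar z ^ 2 - 2 * (noise wstar z * ⟪w - wstar, z.1⟫_ℝ)) D :=
    h.memLp.integrable_sq.sub (h1.const_mul 2)
  unfold risk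
  simp_rw [key]
  rw [integral_add h4 h3, integral_sub h.memLp.integrable_sq (h1.const_mul 2),
    integral_const_mul, h2, inner_cov hD]
  simp only [noise]
  ring

end Noise

section Step

variable {d : ℕ∞} {b : HilbertBasis (Idx d) ℝ E} {lam : Idx d → ℝ} {wstar : E} {β σ : ℝ}

/-- The lower bound on the fourth moment operator at the rank one operator `A = η ηᵀ`, read off in
an eigendirection of the covariance. -/
lemma FourthMomentLower.lower_rankOne (h : FourthMomentLower D b β) (hs : SecondMoment D b lam)
    (η : E) (i : Idx d) :
    lam i ^ 2 * ⟪b i, η⟫_ℝ ^ 2 + β * lam i * ⟪η, cov D η⟫_ℝ ≤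
      ∫ z, ⟪b i, z.1⟫_ℝ ^ 2 * ⟪η, z.1⟫_ℝ ^ 2 ∂D := by
  have key := h.lower (InnerProductSpace.rankOne ℝ η η)
    (InnerProductSpace.isPositive_rankOne_self η) (b i)
  have htr : tr b (cov D ∘L InnerProductSpace.rankOne ℝ η η) = ⟪η, cov D η⟫_ℝ := by
    rw [tr, ← b.tsum_inner_mul_inner η (cov D η)]
    refine tsum_congr fun j => ?_
    simp [inner_smul_right]
  have hform : fourthForm D (InnerProductSpace.rankOne ℝ η η) (b i) =
      ∫ z, ⟪b i, z.1⟫_ℝ ^ 2 * ⟪η, z.1⟫_ℝ ^ 2 ∂D := by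
    refine integral_congr_ae (.of_forall fun z => ?_)
    simp [inner_smul_right, real_inner_comm η, sq]
  have hbb : ⟪b i, b i⟫_ℝ = 1 := by
    rw [real_inner_self_eq_norm_sq, b.orthonormal.1 i, one_pow]
  rw [htr, hform, hs.inner_basis_cov, hbb] at key
  simp only [ContinuousLinearMap.comp_apply, hs.inner_basis_cov,
    InnerProductSpace.rankOne_apply, inner_smul_right] at key
  rw [hs.diagonal, inner_smul_right, real_inner_comm (b i) η] at key
  linarith

/-- Conditionally on the past, a step of SGD from the error `η`, read in an eigendirection through
an affine function, has the squared mean plus at least the stated variance as second moment. -/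
lemma le_integral_step_sq [IsProbabilityMeasure D] (hs : SecondMoment D b lam)
    (hf : FourthMomentLower D b β) (hn : WellSpecified D wstar σ) (η : E) (c k : ℝ) (i : Idx d) :
    (c - k * lam i * ⟪b i, η⟫_ℝ) ^ 2 + k ^ 2 * lam i * (σ ^ 2 + β * ⟪η, cov D η⟫_ℝ) ≤
      ∫ z, (c + k * ((noise wstar z - ⟪η, z.1⟫_ℝ) * ⟪b i, z.1⟫_ℝ)) ^ 2 ∂D := by
  have hxx := integrable_inner_mul_inner hs.integrable
  have hii : Integrable (fun z : E × ℝ => ⟪b i, z.1⟫_ℝ ^ 2) D := by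
    simpa only [sq] using hxx (b i) (b i)
  have hiη := hf.integrable_sq_mul_sq (b i) η
  have hii1 : Integrable (fun z : E × ℝ => ⟪b i, z.1⟫_ℝ) D :=
    ((memLp_two_iff_integrable_sq (by fun_prop)).2 hii).integrable (by norm_num)
  have hiiη : Integrable (fun z : E × ℝ => ⟪η, z.1⟫_ℝ * ⟪b i, z.1⟫_ℝ ^ 2) D := by
    refine (hii.add hiη).mono' (by fun_prop) (.of_forall fun z => ?_)
    rw [norm_mul, norm_pow, Real.norm_eq_abs, Real.norm_eq_abs, sq_abs]
    simp only [Pi.add_apply]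
    have h1 : |⟪η, z.1⟫_ℝ| ≤ 1 + ⟪η, z.1⟫_ℝ ^ 2 := by
      nlinarith [sq_abs ⟪η, z.1⟫_ℝ, sq_nonneg (|⟪η, z.1⟫_ℝ| - 1)]
    nlinarith [mul_le_mul_of_nonneg_right h1 (sq_nonneg ⟪b i, z.1⟫_ℝ)]
  have mi : Measurable fun x : E => ⟪b i, x⟫_ℝ := by fun_prop
  have mii : Measurable fun x : E => ⟪b i, x⟫_ℝ ^ 2 := by fun_prop
  have miiη : Measurable fun x : E => ⟪η, x⟫_ℝ * ⟪b i, x⟫_ℝ ^ 2 := by fun_prop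
  have msq : Measurable fun s : ℝ => s ^ 2 := by fun_prop
  have hξ : Integrable (noise wstar) D := hn.memLp.integrable (by norm_num)
  have i1 : Integrable (fun z => noise wstar z * ⟪b i, z.1⟫_ℝ) D  :=
    (hn.indep.comp measurable_id mi).integrable_mul hξ hii1
  have e1 := hn.integral_mul measurable_id mi
  have i2 : Integrable (fun z => noise wstar z ^ 2 * ⟪b i, z.1⟫_ℝ ^ 2) D  :=
    (hn.indep.comp msq mii).integrable_mul hn.memLp.integrable_sq hii
  have e2 := hn.integral_mul msq mii
  have i3 : Integrable (fun z => noise wstar z * (⟪η, z.1⟫_ℝ * ⟪b i, z.1⟫_ℝ ^ 2)) D  :=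
    (hn.indep.comp measurable_id miiη).integrable_mul hξ hiiη
  have e3 := hn.integral_mul measurable_id miiη
  simp only [id] at e1 e3
  rw [hn.mean, zero_mul] at e1 e3
  have hbb : ⟪b i, b i⟫_ℝ = 1 := by
    rw [real_inner_self_eq_norm_sq, b.orthonormal.1 i, one_pow]
  have e4 : ∫ z : E × ℝ, ⟪b i, z.1⟫_ℝ ^ 2 ∂D = lam i := by
    have := inner_cov hs.integrable (b i) (b i)
    rw [hs.inner_basis_cov, hbb, mul_one] at this
    simp only [this, sq]
  have e5 : ∫ z : E × ℝ, ⟪b i, z.1⟫_ℝ * ⟪η, z.1⟫_ℝ ∂D = lam i * ⟪b i, η⟫_ℝ := by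
    rw [← inner_cov hs.integrable, hs.inner_basis_cov]
  rw [hn.second, e4] at e2
  have hexp : ∀ z : E × ℝ, (c + k * ((noise wstar z - ⟪η, z.1⟫_ℝ) * ⟪b i, z.1⟫_ℝ)) ^ 2 =
      c ^ 2 + (2 * c * k * (noise wstar z * ⟪b i, z.1⟫_ℝ)
      + (-(2 * c * k) * (⟪b i, z.1⟫_ℝ * ⟪η, z.1⟫_ℝ)
      + (k ^ 2 * (noise wstar z ^ 2 * ⟪b i, z.1⟫_ℝ ^ 2)
      + (-(2 * k ^ 2) * (noise wstar z * (⟪η, z.1⟫_ℝ * ⟪b i, z.1⟫_ℝ ^ 2))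
      + k ^ 2 * (⟪b i, z.1⟫_ℝ ^ 2 * ⟪η, z.1⟫_ℝ ^ 2))))) := fun z => by ring
  have j5 := hiη.const_mul (k ^ 2)
  have j4 := (i3.const_mul (-(2 * k ^ 2))).fun_add j5
  have j3 := (i2.const_mul (k ^ 2)).fun_add j4
  have j2 := ((hxx (b i) η).const_mul (-(2 * c * k))).fun_add j3
  have j1 := (i1.const_mul (2 * c * k)).fun_add j2
  simp_rw [hexp]
  rw [integral_add (integrable_const _) j1, integral_add (i1.const_mul _) j2,
    integral_add ((hxx (b i) η).const_mul _) j3, integral_add (i2.const_mul _) j4,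
    integral_add (i3.const_mul _) j5]
  simp only [integral_const_mul, e1, e2, e3, e5, integral_const, probReal_univ, one_smul]
  nlinarith [mul_le_mul_of_nonneg_left (hf.lower_rankOne hs η i) (sq_nonneg k)]

end Step

end OneSample

/-! ### Functions of two independent variables -/

section Independence

variable {Ω A B : Type*} [MeasurableSpace Ω] [MeasurableSpace A] [MeasurableSpace B]
  {P : Measure Ω} {D : Measure B}
  {W : Ω → A} {Y : Ω → B}

lemma map_prodMk_eq [IsProbabilityMeasure P] (hW : AEMeasurable W P) (hY : HasLaw Y D P)
    (h : IndepFun W Y P) : P.map (fun ω => (W ω, Y ω)) = (P.map W).prod D := by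
  rw [(indepFun_iff_map_prod_eq_prod_map_map hW hY.aemeasurable).1 h, hY.map_eq]

/-- Integrability of a function of two independent variables, from a bound on the integrals over
the second variable. -/
lemma integrable_comp_prodMk [IsProbabilityMeasure P] [IsProbabilityMeasure D]
    (hW : AEMeasurable W P) (hY : HasLaw Y D P) (h : IndepFun W Y P)
    {F : A × B → ℝ} (hF : Measurable F) (hFi : ∀ w, Integrable (fun z => F (w, z)) D)
    {g : A → ℝ} (hle : ∀ w, ∫ z, ‖F (w, z)‖ ∂D ≤ g w) (hg : Measurable g)
    (hgi : Integrable (fun ω => g (W ω)) P) :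
    Integrable (fun ω => F (W ω, Y ω)) P := by
  have hm : AEMeasurable (fun ω => (W ω, Y ω)) P := hW.prodMk hY.aemeasurable
  have := Measure.isProbabilityMeasure_map hW
  have key : Integrable F ((P.map W).prod D) := by
    rw [integrable_prod_iff hF.aestronglyMeasurable]
    refine ⟨.of_forall hFi, ?_⟩
    refine ((integrable_map_measure hg.aestronglyMeasurable hW).2 hgi).mono'
      hF.norm.stronglyMeasurable.integral_prod_right'.aestronglyMeasurable
      (.of_forall fun w => ?_)
    rw [Real.norm_of_nonneg (integral_nonneg fun _ => norm_nonneg _)]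
    exact hle w
  rw [← map_prodMk_eq hW hY h] at key
  exact (integrable_map_measure hF.aestronglyMeasurable hm).1 key

lemma integrable_and_integral_comp_prodMk [IsProbabilityMeasure P] [IsProbabilityMeasure D]
    (hW : AEMeasurable W P) (hY : HasLaw Y D P)
    (h : IndepFun W Y P) {F : A × B → ℝ} (hF : Measurable F)
    (hFi : Integrable (fun ω => F (W ω, Y ω)) P) :
    Integrable (fun ω => ∫ z, F (W ω, z) ∂D) P ∧
      ∫ ω, F (W ω, Y ω) ∂P = ∫ ω, ∫ z, F (W ω, z) ∂D ∂P := by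
  have hm : AEMeasurable (fun ω => (W ω, Y ω)) P := hW.prodMk hY.aemeasurable
  have := Measure.isProbabilityMeasure_map hW
  have key : Integrable F ((P.map W).prod D) := by
    rw [← map_prodMk_eq hW hY h]
    exact (integrable_map_measure hF.aestronglyMeasurable hm).2 hFi
  have hs : AEStronglyMeasurable (fun w => ∫ z, F (w, z) ∂D) (P.map W) :=
    hF.stronglyMeasurable.integral_prod_right'.aestronglyMeasurable
  constructor
  · exact (integrable_map_measure hs hW).1 key.integral_prod_left
  · rw [← integral_map hm hF.aestronglyMeasurable, map_prodMk_eq hW hY h, integral_prod _ key,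
      integral_map hW hs]

end Independence

/-! ### The iterates and their past -/

section Iterates

variable {E : Type*} [NormedAddCommGroup E] [InnerProductSpace ℝ E]
  {δ α : ℝ} {w0 wstar : E}

lemma sgd_congr {z z' : ℕ → E × ℝ} {t : ℕ} (h : ∀ s < t, z s = z' s) :
    sgd δ w0 z t = sgd δ w0 z' t := by
  induction t with
  | zero => rfl
  | succ t ih => simp only [sgd, ih fun s hs => h s (by omega), h t (by omega)]

lemma ema_congr {z z' : ℕ → E × ℝ} {t : ℕ} (h : ∀ s < t, z s = z' s) :
    ema δ α w0 z t = ema δ α w0 z' t := by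
  induction t with
  | zero => rfl
  | succ t ih =>
    simp only [ema, ih fun s hs => h s (by omega), sgd_congr fun s hs => h s (Nat.lt_succ_of_lt hs)]

lemma sgd_succ_sub (z : ℕ → E × ℝ) (t : ℕ) : sgd δ w0 z (t + 1) - wstar =
    (sgd δ w0 z t - wstar) +
      δ • ((noise wstar (z t) - ⟪sgd δ w0 z t - wstar, (z t).1⟫_ℝ) • (z t).1) := by
  simp only [sgd, noise, inner_sub_left, smul_smul, sub_sub_sub_cancel_right]
  abel

lemma ema_succ_sub (z : ℕ → E × ℝ) (t : ℕ) : ema δ α w0 z (t + 1) - wstar =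
    α • (ema δ α w0 z t - wstar) + (1 - α) • (sgd δ w0 z t - wstar) := by
  simp only [ema]; module

variable [SecondCountableTopology E] [MeasurableSpace E] [BorelSpace E]

lemma measurable_sgd (t : ℕ) : Measurable fun z : ℕ → E × ℝ => sgd δ w0 z t := by
  induction t with
  | zero => exact measurable_const
  | succ t ih => unfold sgd; fun_prop

lemma measurable_ema (t : ℕ) : Measurable fun z : ℕ → E × ℝ => ema δ α w0 z t := by
  induction t with
  | zero => exact measurable_const
  | succ t ih =>
    have := measurable_sgd (δ := δ) (w0 := w0) t
    unfold ema; fun_prop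

variable {Ω : Type*} [MeasurableSpace Ω] {P : Measure Ω}
  {D : Measure (E × ℝ)} {Z : ℕ → Ω → E × ℝ}

/-- The pair of the errors of the moving average and of the SGD iterate after `t` steps. -/
def errors (δ α : ℝ) (w0 wstar : E) (z : ℕ → E × ℝ) (t : ℕ) : E × E :=
  (ema δ α w0 z t - wstar, sgd δ w0 z t - wstar)

lemma measurable_errors (t : ℕ) :
    Measurable fun z : ℕ → E × ℝ => errors δ α w0 wstar z t :=
  ((measurable_ema t).sub_const _).prodMk ((measurable_sgd t).sub_const _)

lemma aemeasurable_errors (hlaw : ∀ t, HasLaw (Z t) D P) (t : ℕ) :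
    AEMeasurable (fun ω => errors δ α w0 wstar (fun s => Z s ω) t) P :=
  (measurable_errors t).comp_aemeasurable
    (aemeasurable_pi_lambda _ fun s => (hlaw s).aemeasurable)

lemma indepFun_errors [IsProbabilityMeasure P]
    (hlaw : ∀ t, HasLaw (Z t) D P) (hindep : iIndepFun Z P) (t : ℕ) :
    IndepFun (fun ω => errors δ α w0 wstar (fun s => Z s ω) t) (Z t) P := by
  classical
  have h := hindep.indepFun_finset₀ (Finset.range t) {t} (by simp) fun s => (hlaw s).aemeasurable
  let ext : (Finset.range t → E × ℝ) → ℕ → E × ℝ :=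
    fun f s => if hs : s ∈ Finset.range t then f ⟨s, hs⟩ else 0
  have hext : Measurable ext := by
    refine measurable_pi_lambda _ fun s => ?_
    by_cases hs : s ∈ Finset.range t
    · simp only [ext, hs, dite_true]; exact measurable_pi_apply _
    · simp only [ext, hs, dite_false]; exact measurable_const
  have h2 := h.comp ((measurable_errors (δ := δ) (α := α) (w0 := w0) (wstar := wstar) t).comp hext)
    (measurable_pi_apply (⟨t, Finset.mem_singleton_self t⟩ : ({t} : Finset ℕ)))
  refine h2.congr (.of_forall fun ω => ?_) .rfl
  have h3 : ∀ s < t, Z s ω = ext (fun i : Finset.range t => Z i ω) s := by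
    intro s hs; simp [ext, hs]
  simp only [Function.comp_apply, errors]
  rw [sgd_congr h3, ema_congr h3]

end Iterates

/-! ### Second moments of the iterates -/

section SquareIntegrable

variable {Ω E : Type*} [MeasurableSpace Ω] {P : Measure Ω} [NormedAddCommGroup E]
  [InnerProductSpace ℝ E]

lemma integrable_combo_sq {U V : Ω → E} (hU : MemLp U 2 P) (hV : MemLp V 2 P) (v : E) (A B : ℝ) :
    Integrable (fun ω => (A * ⟪v, U ω⟫_ℝ + B * ⟪v, V ω⟫_ℝ) ^ 2) P :=
  (((hU.const_inner v).const_mul A).add ((hV.const_inner v).const_mul B)).integrable_sq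

lemma integrable_inner_apply {V : Ω → E} (hV : MemLp V 2 P) (T : E →L[ℝ] E) :
    Integrable (fun ω => ⟪V ω, T (V ω)⟫_ℝ) P := by
  refine ((hV.integrable_norm_pow (by norm_num)).const_mul ‖T‖).mono'
    (hV.1.inner (T.continuous.comp_aestronglyMeasurable hV.1)) (.of_forall fun ω => ?_)
  calc ‖⟪V ω, T (V ω)⟫_ℝ‖ ≤ ‖V ω‖ * (‖T‖ * ‖V ω‖) :=
        (norm_inner_le_norm _ _).trans (by gcongr; exact T.le_opNorm _)
    _ = ‖T‖ * ‖V ω‖ ^ 2 := by ring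

end SquareIntegrable

section Moments

variable {E : Type*} [NormedAddCommGroup E] [InnerProductSpace ℝ E]
  [SecondCountableTopology E] [MeasurableSpace E] [BorelSpace E]
  {Ω : Type*} [MeasurableSpace Ω] {P : Measure Ω}
  {D : Measure (E × ℝ)} {Z : ℕ → Ω → E × ℝ}
  {d : ℕ∞} {b : HilbertBasis (Idx d) ℝ E} {lam : Idx d → ℝ} {w0 wstar : E} {β σ δ α : ℝ}

/-- The errors have finite second moments. The fourth moment `𝔼‖x‖⁴` may be infinite: what bounds
the second moment of a step is the boundedness of the operator `𝔼[‖x‖² x xᵀ]`. -/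
lemma memLp_errors [IsProbabilityMeasure P] [IsProbabilityMeasure D]
    (hs : SecondMoment D b lam) (hf : FourthMomentLower D b β)
    (hn : WellSpecified D wstar σ) (hlaw : ∀ t, HasLaw (Z t) D P) (hindep : iIndepFun Z P)
    (t : ℕ) :
    MemLp (fun ω => ema δ α w0 (fun s => Z s ω) t - wstar) 2 P ∧
      MemLp (fun ω => sgd δ w0 (fun s => Z s ω) t - wstar) 2 P := by
  induction t with
  | zero => exact ⟨memLp_const (w0 - wstar), memLp_const (w0 - wstar)⟩
  | succ t ih =>
    simp_rw [ema_succ_sub, sgd_succ_sub]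
    refine ⟨(ih.1.const_smul α).add (ih.2.const_smul (1 - α)), ih.2.add (.const_smul ?_ δ)⟩
    have hW := aemeasurable_errors (δ := δ) (α := α) (w0 := w0) (wstar := wstar) hlaw t
    have hI := indepFun_errors (δ := δ) (α := α) (w0 := w0) (wstar := wstar) hlaw hindep t
    have hmn := measurable_noise wstar
    have hmeas : Measurable fun p : (E × E) × (E × ℝ) =>
        (noise wstar p.2 - ⟪p.1.2, p.2.1⟫_ℝ) • p.2.1 := by fun_prop
    have hstep : AEMeasurable (fun ω => (noise wstar (Z t ω)
        - ⟪sgd δ w0 (fun s => Z s ω) t - wstar, (Z t ω).1⟫_ℝ) • (Z t ω).1) P :=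
      hmeas.comp_aemeasurable (hW.prodMk (hlaw t).aemeasurable)
    rw [memLp_two_iff_integrable_sq_norm hstep.aestronglyMeasurable]
    obtain ⟨C, hC⟩ := hf.finite
    have i1 : Integrable (fun z => noise wstar z ^ 2 * ‖z.1‖ ^ 2) D :=
      (hn.indep.comp (φ := fun s : ℝ => s ^ 2) (ψ := fun x : E => ‖x‖ ^ 2) (by fun_prop)
        (by fun_prop)).integrable_mul hn.memLp.integrable_sq hs.integrable
    have hpt : ∀ (w : E × E) (z : E × ℝ), ‖(noise wstar z - ⟪w.2, z.1⟫_ℝ) • z.1‖ ^ 2 ≤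
        2 * (noise wstar z ^ 2 * ‖z.1‖ ^ 2) + 2 * (⟪w.2, z.1⟫_ℝ ^ 2 * ‖z.1‖ ^ 2) := by
      intro w z
      rw [norm_smul, mul_pow, Real.norm_eq_abs, sq_abs, ← mul_assoc, ← mul_assoc, ← add_mul]
      refine mul_le_mul_of_nonneg_right ?_ (sq_nonneg _)
      nlinarith [sq_nonneg (noise wstar z + ⟪w.2, z.1⟫_ℝ)]
    have i2 : ∀ w : E × E, Integrable (fun z => 2 * (noise wstar z ^ 2 * ‖z.1‖ ^ 2)
        + 2 * (⟪w.2, z.1⟫_ℝ ^ 2 * ‖z.1‖ ^ 2)) D := fun w =>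
      (i1.const_mul 2).fun_add ((hf.integrable w.2).const_mul 2)
    have i3 : ∀ w : E × E, Integrable
        (fun z => ‖(noise wstar z - ⟪w.2, z.1⟫_ℝ) • z.1‖ ^ 2) D := fun w =>
      (i2 w).mono' (by fun_prop) (.of_forall fun z => by
        rw [Real.norm_of_nonneg (sq_nonneg _)]; exact hpt w z)
    refine integrable_comp_prodMk hW (hlaw t) hI (hmeas.norm.pow_const 2) i3
      (g := fun w => 2 * (∫ z, noise wstar z ^ 2 * ‖z.1‖ ^ 2 ∂D) + 2 * (C * ‖w.2‖ ^ 2))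
      (fun w => ?_) (by fun_prop) ?_
    · simp_rw [Real.norm_of_nonneg (sq_nonneg _)]
      refine (integral_mono (i3 w) (i2 w) (hpt w)).trans ?_
      rw [integral_add (i1.const_mul 2) ((hf.integrable w.2).const_mul 2), integral_const_mul,
        integral_const_mul]
      have := hC w.2
      gcongr
    · have := (ih.2.integrable_norm_pow (by norm_num)).const_mul C
      exact (integrable_const _).add (this.const_mul 2)

variable [CompleteSpace E]

/-- The second moment, in the eigendirection `b i`, of the combination with coefficients `A`, `B`
of the errors of the moving average and of the SGD iterate after `t` steps. -/
def comboSq (P : Measure Ω) (Z : ℕ → Ω → E × ℝ) (b : HilbertBasis (Idx d) ℝ E) (w0 wstar : E)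
    (δ α : ℝ) (i : Idx d) (t : ℕ) (A B : ℝ) : ℝ :=
  ∫ ω, (A * ⟪b i, ema δ α w0 (fun s => Z s ω) t - wstar⟫_ℝ
    + B * ⟪b i, sgd δ w0 (fun s => Z s ω) t - wstar⟫_ℝ) ^ 2 ∂P

/-- The expectation of `⟨η, H η⟩` for the error `η` of the SGD iterate after `t` steps. -/
def sgdExcess (P : Measure Ω) (Z : ℕ → Ω → E × ℝ) (D : Measure (E × ℝ)) (w0 wstar : E) (δ : ℝ)
    (t : ℕ) : ℝ :=
  ∫ ω, ⟪sgd δ w0 (fun s => Z s ω) t - wstar, cov D (sgd δ w0 (fun s => Z s ω) t - wstar)⟫_ℝ ∂P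

/-- One step of the backward recursion for the second moments. -/
lemma comboSq_succ [IsProbabilityMeasure P] [IsProbabilityMeasure D]
    (hs : SecondMoment D b lam) (hf : FourthMomentLower D b β)
    (hn : WellSpecified D wstar σ) (hlaw : ∀ t, HasLaw (Z t) D P) (hindep : iIndepFun Z P)
    (i : Idx d) (t : ℕ) (A B : ℝ) :
    comboSq P Z b w0 wstar δ α i t (α * A) ((1 - α) * A + (1 - δ * lam i) * B)
      + B ^ 2 * (δ ^ 2 * lam i * (σ ^ 2 + β * sgdExcess P Z D w0 wstar δ t))
      ≤ comboSq P Z b w0 wstar δ α i (t + 1) A B := by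
  have hW := aemeasurable_errors (δ := δ) (α := α) (w0 := w0) (wstar := wstar) hlaw t
  have hI := indepFun_errors (δ := δ) (α := α) (w0 := w0) (wstar := wstar) hlaw hindep t
  have hL := memLp_errors (δ := δ) (α := α) (w0 := w0) hs hf hn hlaw hindep t
  have hL' := memLp_errors (δ := δ) (α := α) (w0 := w0) hs hf hn hlaw hindep (t + 1)
  have hmn := measurable_noise wstar
  let F : (E × E) × (E × ℝ) → ℝ := fun p =>
    ((α * A * ⟪b i, p.1.1⟫_ℝ + ((1 - α) * A + B) * ⟪b i, p.1.2⟫_ℝ)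
      + B * δ * ((noise wstar p.2 - ⟪p.1.2, p.2.1⟫_ℝ) * ⟪b i, p.2.1⟫_ℝ)) ^ 2
  have hF : Measurable F := by fun_prop
  have heq : ∀ ω, F (errors δ α w0 wstar (fun s => Z s ω) t, Z t ω) =
      (A * ⟪b i, ema δ α w0 (fun s => Z s ω) (t + 1) - wstar⟫_ℝ
        + B * ⟪b i, sgd δ w0 (fun s => Z s ω) (t + 1) - wstar⟫_ℝ) ^ 2 := by
    intro ω
    rw [ema_succ_sub, sgd_succ_sub]
    simp only [F, errors, inner_add_right, inner_smul_right]
    ring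
  have hFi : Integrable (fun ω => F (errors δ α w0 wstar (fun s => Z s ω) t, Z t ω)) P := by
    simp_rw [heq]
    exact integrable_combo_sq hL'.1 hL'.2 _ _ _
  obtain ⟨j1, j2⟩ := integrable_and_integral_comp_prodMk hW (hlaw t) hI hF hFi
  have j3 := integrable_combo_sq hL.1 hL.2 (b i) (α * A) ((1 - α) * A + (1 - δ * lam i) * B)
  have j4 : Integrable (fun ω => B ^ 2 * (δ ^ 2 * lam i * (σ ^ 2 + β *
      ⟪sgd δ w0 (fun s => Z s ω) t - wstar, cov D (sgd δ w0 (fun s => Z s ω) t - wstar)⟫_ℝ))) P :=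
    ((((integrable_const _).fun_add ((integrable_inner_apply hL.2 (cov D)).const_mul β)).const_mul
      _).const_mul _)
  have j5 := integral_mono (j3.fun_add j4) j1 fun ω => by
    refine le_trans (le_of_eq ?_) (le_integral_step_sq hs hf hn
      (sgd δ w0 (fun s => Z s ω) t - wstar)
      (α * A * ⟪b i, ema δ α w0 (fun s => Z s ω) t - wstar⟫_ℝ
        + ((1 - α) * A + B) * ⟪b i, sgd δ w0 (fun s => Z s ω) t - wstar⟫_ℝ) (B * δ) i)
    ring
  rw [← j2, integral_add j3 j4, integral_const_mul, integral_const_mul,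
    integral_add (integrable_const _) ((integrable_inner_apply hL.2 (cov D)).const_mul β),
    integral_const_mul, integral_const, probReal_univ, one_smul] at j5
  simp_rw [heq] at j5
  exact j5

lemma sgdExcess_nonneg (hs : SecondMoment D b lam) (t : ℕ) :
    0 ≤ sgdExcess P Z D w0 wstar δ t :=
  integral_nonneg fun _ => inner_cov_self_nonneg hs.integrable _

/-- Unrolling the recursion: if the excess of the first `N` iterates is at least `κ`, then the
second moment is at least the squared mean plus a sum over the injected variances. -/
lemma le_comboSq [IsProbabilityMeasure P] [IsProbabilityMeasure D]
    (hs : SecondMoment D b lam) (hf : FourthMomentLower D b β)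
    (hn : WellSpecified D wstar σ) (hlaw : ∀ t, HasLaw (Z t) D P) (hindep : iIndepFun Z P)
    (i : Idx d) {κ : ℝ} {N : ℕ} (hκ : ∀ t < N, κ ≤ sgdExcess P Z D w0 wstar δ t)
    {t : ℕ} (ht : t ≤ N) (A B : ℝ) :
    ((A * (α ^ t + (1 - α) * emaWeight α (1 - δ * lam i) t) + B * (1 - δ * lam i) ^ t)
        * ⟪b i, w0 - wstar⟫_ℝ) ^ 2
      + δ ^ 2 * lam i * (σ ^ 2 + β * κ) * ∑ n ∈ Finset.range t,
        (A * ((1 - α) * emaWeight α (1 - δ * lam i) n) + B * (1 - δ * lam i) ^ n) ^ 2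
      ≤ comboSq P Z b w0 wstar δ α i t A B := by
  induction t generalizing A B with
  | zero =>
    simp only [comboSq, ema, sgd, integral_const, probReal_univ, one_smul, emaWeight_zero,
      Finset.range_zero, Finset.sum_empty, pow_zero]
    exact le_of_eq (by ring)
  | succ t ih =>
    have h1 := ih (by omega) (α * A) ((1 - α) * A + (1 - δ * lam i) * B)
    have h2 := comboSq_succ (w0 := w0) (δ := δ) (α := α) hs hf hn hlaw hindep i t A B
    have h3 : B ^ 2 * (δ ^ 2 * lam i * (σ ^ 2 + β * κ)) ≤
        B ^ 2 * (δ ^ 2 * lam i * (σ ^ 2 + β * sgdExcess P Z D w0 wstar δ t)) := by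
      have := hf.pos
      have := hs.pos i
      have := hκ t (by omega)
      gcongr
    refine le_trans (le_of_eq ?_) ((add_le_add h1 h3).trans h2)
    rw [Finset.sum_range_succ']
    have h4 : ∀ n, A * ((1 - α) * emaWeight α (1 - δ * lam i) (n + 1))
        + B * (1 - δ * lam i) ^ (n + 1) = α * A * ((1 - α) * emaWeight α (1 - δ * lam i) n)
          + ((1 - α) * A + (1 - δ * lam i) * B) * (1 - δ * lam i) ^ n := by
      intro n; rw [emaWeight_succ]; ring
    simp_rw [h4]
    rw [emaWeight_succ, emaWeight_zero]
    ring

lemma hasSum_integral_inner_sq (hs : SecondMoment D b lam) {V : Ω → E} (hV : MemLp V 2 P) :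
    HasSum (fun i => lam i * ∫ ω, ⟪b i, V ω⟫_ℝ ^ 2 ∂P) (∫ ω, ⟪V ω, cov D (V ω)⟫_ℝ ∂P) := by
  have hpt : ∀ ω, HasSum (fun i => lam i * ⟪b i, V ω⟫_ℝ ^ 2) ⟪V ω, cov D (V ω)⟫_ℝ :=
    fun ω => hs.hasSum_inner_cov (V ω)
  simp_rw [← integral_const_mul]
  refine hasSum_integral_of_dominated_convergence (fun i ω => lam i * ⟪b i, V ω⟫_ℝ ^ 2)
    (fun i => ?_) (fun i => .of_forall fun ω => ?_) (.of_forall fun ω => (hpt ω).summable) ?_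
    (.of_forall hpt)
  · exact ((hV.const_inner (b i)).integrable_sq.const_mul (lam i)).aestronglyMeasurable
  · rw [Real.norm_of_nonneg (mul_nonneg (hs.pos i).le (sq_nonneg _))]
  · simp_rw [(hpt _).tsum_eq]
    exact integrable_inner_apply hV (cov D)

end Moments

/-! ### Spectral cutoffs -/

section Cutoff

variable {d : ℕ∞} {lam : Idx d → ℝ}

lemma finite_setOf_le (hsum : Summable lam) {c : ℝ} (hc : 0 < c) : {i | c ≤ lam i}.Finite := by
  have h := hsum.tendsto_cofinite_zero.eventually (gt_mem_nhds hc)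
  rw [Filter.eventually_cofinite] at h
  simpa only [not_lt] using h

lemma cutoff_bddAbove (hsum : Summable lam) {c : ℝ} (hc : 0 < c) :
    BddAbove {k : ℕ | ∃ i : Idx d, (i : ℕ) = k ∧ c ≤ lam i} := by
  refine (((finite_setOf_le hsum hc).image fun i : Idx d => (i : ℕ)).subset ?_).bddAbove
  rintro k ⟨i, rfl, hi⟩
  exact ⟨i, hi, rfl⟩

lemma exists_eq_cutoff (hsum : Summable lam) {c : ℝ} (hc : 0 < c) (h0 : cutoff lam c ≠ 0) :
    ∃ i : Idx d, (i : ℕ) = cutoff lam c ∧ c ≤ lam i := by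
  refine Nat.sSup_mem (Set.nonempty_iff_ne_empty.2 fun he => h0 ?_) (cutoff_bddAbove hsum hc)
  rw [cutoff, he, csSup_empty]; rfl

lemma le_cutoff_iff (hanti : Antitone lam) (hsum : Summable lam) {c : ℝ} (hc : 0 < c) (i : Idx d) :
    (i : ℕ) ≤ cutoff lam c ↔ c ≤ lam i := by
  constructor
  · intro h
    obtain ⟨j, hj, hcj⟩ := exists_eq_cutoff hsum hc (by have := i.2.1; omega)
    exact hcj.trans (hanti (Subtype.coe_le_coe.1 (hj ▸ h)))
  · exact fun h => le_csSup (cutoff_bddAbove hsum hc) ⟨i, rfl, h⟩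

/-- There are `cutoff lam c` indices up to `cutoff lam c`: the cutoff does not exceed the
dimension. -/
lemma hasSum_le_cutoff (hsum : Summable lam) {c : ℝ} (hc : 0 < c) :
    HasSum (fun i : Idx d => if (i : ℕ) ≤ cutoff lam c then (1 : ℝ) else 0) (cutoff lam c) := by
  set k := cutoff lam c with hk
  have hd : (k : ℕ∞) ≤ d := by
    by_cases h0 : k = 0
    · simp [h0]
    · obtain ⟨j, hj, -⟩ := exists_eq_cutoff hsum hc h0
      rw [hk, ← hj]; exact j.2.2
  refine (hasSum_subtype_iff_indicator (s := {i : ℕ | 1 ≤ i ∧ (i : ℕ∞) ≤ d})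
    (f := fun n : ℕ => if n ≤ k then (1 : ℝ) else 0)).2 ?_
  have h1 : ∀ n ∈ Finset.Icc 1 k, Set.indicator {i : ℕ | 1 ≤ i ∧ (i : ℕ∞) ≤ d}
      (fun n : ℕ => if n ≤ k then (1 : ℝ) else 0) n = 1 := by
    intro n hn
    rw [Finset.mem_Icc] at hn
    have hnd : (n : ℕ∞) ≤ d := le_trans (by exact_mod_cast hn.2) hd
    rw [Set.indicator_of_mem (show n ∈ {i : ℕ | 1 ≤ i ∧ (i : ℕ∞) ≤ d} from ⟨hn.1, hnd⟩),
      if_pos hn.2]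
  have h2 : ∀ n ∉ Finset.Icc 1 k, Set.indicator {i : ℕ | 1 ≤ i ∧ (i : ℕ∞) ≤ d}
      (fun n : ℕ => if n ≤ k then (1 : ℝ) else 0) n = 0 := by
    intro n hn
    rw [Finset.mem_Icc] at hn
    by_cases h : n ∈ {i : ℕ | 1 ≤ i ∧ (i : ℕ∞) ≤ d}
    · rw [Set.indicator_of_mem h, if_neg fun h3 => hn ⟨h.1, h3⟩]
    · exact Set.indicator_of_notMem h _
  have h3 := hasSum_sum_of_ne_finset_zero (L := .unconditional ℕ) h2
  rw [Finset.sum_congr rfl h1] at h3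
  simpa using h3

/-- The contribution of the index `i` to `varBracket`. -/
def varTerm (lam : Idx d → ℝ) (δ α : ℝ) (N : ℕ) (i : Idx d) : ℝ :=
  3 * α ^ 2 * (1 - α) / 16 * (if (i : ℕ) ≤ kStar lam δ α then 1 else 0)
    + δ / 100 * (if kStar lam δ α < (i : ℕ) ∧ (i : ℕ) ≤ kDagger lam δ N then lam i else 0)
    + N * δ ^ 2 / 180 * (if kDagger lam δ N < (i : ℕ) then lam i ^ 2 else 0)

lemma hasSum_varTerm (hpos : ∀ i, 0 < lam i) (hsum : Summable lam) {δ α : ℝ} (hδ0 : 0 < δ)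
    (hα1 : α < 1) (N : ℕ) (hle : ∀ i, δ * lam i ≤ 1) :
    HasSum (varTerm lam δ α N) (varBracket lam δ α N) := by
  have h1 : HasSum (fun i : Idx d => if (i : ℕ) ≤ kStar lam δ α then (1 : ℝ) else 0)
      (kStar lam δ α) := hasSum_le_cutoff hsum (div_pos (by linarith) hδ0)
  have h2 : Summable fun i : Idx d =>
      if kStar lam δ α < (i : ℕ) ∧ (i : ℕ) ≤ kDagger lam δ N then lam i else 0 := by
    refine Summable.of_nonneg_of_le (fun i => ?_) (fun i => ?_) hsum <;> split_ifs
    exacts [(hpos i).le, le_rfl, le_rfl, (hpos i).le]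
  have h3 : Summable fun i : Idx d => if kDagger lam δ N < (i : ℕ) then lam i ^ 2 else 0 := by
    refine Summable.of_nonneg_of_le (fun i => ?_) (fun i => ?_) (hsum.mul_left (1 / δ)) <;>
      split_ifs
    · exact sq_nonneg _
    · exact le_rfl
    · rw [sq]
      refine mul_le_mul_of_nonneg_right ?_ (hpos i).le
      rw [le_div_iff₀ hδ0]; linarith [hle i]
    · have := hpos i; positivity
  have h4 := ((h1.mul_left (3 * α ^ 2 * (1 - α) / 16)).add (h2.hasSum.mul_left (δ / 100))).add
    (h3.hasSum.mul_left (N * δ ^ 2 / 180))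
  have h5 : varBracket lam δ α N = 3 * α ^ 2 * (1 - α) / 16 * kStar lam δ α
      + δ / 100 * (∑' i : Idx d,
        if kStar lam δ α < (i : ℕ) ∧ (i : ℕ) ≤ kDagger lam δ N then lam i else 0)
      + N * δ ^ 2 / 180 * (∑' i : Idx d, if kDagger lam δ N < (i : ℕ) then lam i ^ 2 else 0) := by
    unfold varBracket; ring
  rw [h5]
  exact h4

/-- In each of the three spectral ranges, the squared weights dominate the matching term of the
bracket. -/
lemma varTerm_le (hanti : Antitone lam) (hpos : ∀ i, 0 < lam i) (hsum : Summable lam) {δ α : ℝ}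
    (hδ0 : 0 < δ) (hα0 : 0 < α) (hα1 : α < 1) {N : ℕ} (hN : 2 ≤ N)
    (hαN : α ^ (N - 1) ≤ 1 / (N : ℝ)) (hle : ∀ i, δ * lam i ≤ 1) (i : Idx d) :
    varTerm lam δ α N i / 2 ≤ (δ * lam i) ^ 2 * (1 - α) ^ 2 *
      ∑ n ∈ Finset.range N, emaWeight α (1 - δ * lam i) n ^ 2 := by
  have hN0 : (0 : ℝ) < N := by exact_mod_cast (by omega : 0 < N)
  have hq0 : 0 < δ * lam i := mul_pos hδ0 (hpos i)
  have hstar : (i : ℕ) ≤ kStar lam δ α ↔ 1 - α ≤ δ * lam i := by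
    rw [kStar, le_cutoff_iff hanti hsum (div_pos (by linarith) hδ0), div_le_iff₀ hδ0, mul_comm]
  have hdag : (i : ℕ) ≤ kDagger lam δ N ↔ 1 / N ≤ δ * lam i := by
    rw [kDagger, le_cutoff_iff hanti hsum (by positivity), ← div_div, div_le_iff₀ hδ0, mul_comm δ]
  have hpN := one_div_le_one_sub hα0 hN hαN
  rcases le_or_gt (1 - α) (δ * lam i) with h | h
  · have h1 := hstar.2 h
    have h2 := hdag.2 (hpN.trans h)
    have h3 := weights_bound_of_le hα0 hα1 (hle i) hN hαN h
    rw [varTerm, if_pos h1, if_neg (by omega), if_neg (by omega)]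
    linarith
  have h1 := mt hstar.1 (not_le.2 h)
  rcases le_or_gt (1 / (N : ℝ)) (δ * lam i) with h' | h'
  · have h2 := hdag.2 h'
    have h3 := weights_bound_of_between hα0 hα1 hN h' h.le
    rw [varTerm, if_neg h1, if_pos ⟨by omega, h2⟩, if_neg (by omega)]
    linarith
  · have h2 := mt hdag.1 (not_le.2 h')
    have h3 := weights_bound_of_lt hα0 hα1 hq0 hN hαN h'.le
    rw [varTerm, if_neg h1, if_neg (by omega), if_pos (by omega)]
    linarith

end Cutoff

/-! ### The excess of the SGD iterates -/

section Excess

variable {E : Type*} [NormedAddCommGroup E] [InnerProductSpace ℝ E] [CompleteSpace E]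
  [SecondCountableTopology E] [MeasurableSpace E] [BorelSpace E]
  {Ω : Type*} [MeasurableSpace Ω] {P : Measure Ω} [IsProbabilityMeasure P]
  {D : Measure (E × ℝ)} [IsProbabilityMeasure D] {Z : ℕ → Ω → E × ℝ}
  {d : ℕ∞} {b : HilbertBasis (Idx d) ℝ E} {lam : Idx d → ℝ} {w0 wstar : E} {β σ δ : ℝ}

/-- The initial error beyond `k^†` survives the first `N` iterates up to a constant factor, because
there a step multiplies the mean by more than `1 - 1 / N`. -/
lemma tailNormSq_le_sgdExcess (hs : SecondMoment D b lam) (hf : FourthMomentLower D b β)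
    (hn : WellSpecified D wstar σ) (hlaw : ∀ t, HasLaw (Z t) D P) (hindep : iIndepFun Z P)
    (hδ0 : 0 < δ) {N t : ℕ} (ht : t < N) :
    Real.exp (-2) * tailNormSq lam (fun i => ⟪b i, w0 - wstar⟫_ℝ) (kDagger lam δ N) ≤
      sgdExcess P Z D w0 wstar δ t := by
  have hN0 : (0 : ℝ) < N := by exact_mod_cast (by omega : 0 < N)
  have hsummable : Summable fun i : Idx d =>
      if kDagger lam δ N < (i : ℕ) then lam i * ⟪b i, w0 - wstar⟫_ℝ ^ 2 else 0 := by
    refine Summable.of_nonneg_of_le (fun i => ?_) (fun i => ?_)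
      (hs.hasSum_inner_cov (w0 - wstar)).summable <;> have := hs.pos i <;> split_ifs <;>
      first | positivity | rfl
  -- the averaging parameter plays no role for the SGD iterate, so `0` is as good as any
  have hL := (memLp_errors (δ := δ) (α := 0) (w0 := w0) hs hf hn hlaw hindep t).2
  refine hasSum_le (fun i => ?_) (hsummable.hasSum.mul_left (Real.exp (-2)))
    (hasSum_integral_inner_sq hs hL)
  have hpos := hs.pos i
  split_ifs with hi
  · have hq : δ * lam i < 1 / N := by
      by_contra hcon
      refine (not_le.2 hi) ((le_cutoff_iff hs.antitone hs.summable (by positivity) i).2 ?_)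
      rw [← div_div, div_le_iff₀ hδ0, mul_comm (lam i)]
      exact not_lt.1 hcon
    have hle := le_comboSq (w0 := w0) (δ := δ) (α := 0) hs hf hn hlaw hindep i (κ := 0)
      (fun _ _ => sgdExcess_nonneg hs _) (le_refl t) 0 1
    simp only [comboSq, zero_mul, zero_add, one_mul, mul_zero, add_zero] at hle
    have hpow : Real.exp (-1) ≤ (1 - δ * lam i) ^ t := by
      refine exp_neg_one_le_pow ?_
      have htN : (t : ℝ) + 1 ≤ N := by exact_mod_cast ht
      have hq0 : 0 < δ * lam i := by positivity
      rw [lt_div_iff₀ hN0] at hq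
      nlinarith
    have hexp : Real.exp (-2) = Real.exp (-1) ^ 2 := by
      rw [← Real.exp_nat_mul]; norm_num
    calc Real.exp (-2) * (lam i * ⟪b i, w0 - wstar⟫_ℝ ^ 2)
        = lam i * (Real.exp (-1) ^ 2 * ⟪b i, w0 - wstar⟫_ℝ ^ 2) := by rw [hexp]; ring
      _ ≤ lam i * (((1 - δ * lam i) ^ t) ^ 2 * ⟪b i, w0 - wstar⟫_ℝ ^ 2) := by gcongr
      _ = lam i * (((1 - δ * lam i) ^ t * ⟪b i, w0 - wstar⟫_ℝ) ^ 2) := by ring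
      _ ≤ _ := by
        refine mul_le_mul_of_nonneg_left (le_trans ?_ hle) hpos.le
        refine le_add_of_nonneg_right ?_
        positivity
  · rw [mul_zero]
    exact mul_nonneg hpos.le (integral_nonneg fun _ => sq_nonneg _)

end Excess

end EMARegression

end

theorem theorem2 {E : Type*} [NormedAddCommGroup E] [InnerProductSpace ℝ E] [CompleteSpace E]
    [SecondCountableTopology E] [MeasurableSpace E] [BorelSpace E]
    {Ω : Type*} [MeasurableSpace Ω] (P : Measure Ω) [IsProbabilityMeasure P]
    (d : ℕ∞) (hd : ((1 : ℕ) : ℕ∞) ≤ d)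
    (b : HilbertBasis (EMARegression.Idx d) ℝ E) (lam : EMARegression.Idx d → ℝ)
    (D : Measure (E × ℝ)) [IsProbabilityMeasure D]
    (wstar w0 : E) (β σ δ α : ℝ) (N : ℕ)
    (hmin : ∀ w : E, EMARegression.risk D wstar ≤ EMARegression.risk D w)
    (hsecond : EMARegression.SecondMoment D b lam)
    (hfourth : EMARegression.FourthMomentLower D b β)
    (hnoise : EMARegression.WellSpecified D wstar σ)
    (Z : ℕ → Ω → E × ℝ) (hlaw : ∀ t, HasLaw (Z t) D P) (hindep : iIndepFun Z P)
    (hδ0 : 0 < δ) (hδ : δ ≤ 1 / lam (EMARegression.Idx.first hd))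
    (hα0 : 0 < α) (hα1 : α < 1)
    (hN : 2 ≤ N) (hαN : α ^ (N - 1) ≤ 1 / (N : ℝ)) :
    Integrable (fun ω => EMARegression.risk D
      (EMARegression.ema δ α w0 (fun t => Z t ω) N)) P ∧
    ∃ effectiveVar : ℝ,
      (∫ ω, EMARegression.risk D (EMARegression.ema δ α w0 (fun t => Z t ω) N) ∂P)
          - EMARegression.risk D wstar
        = (EMARegression.effectiveBias lam (fun i => ⟪b i, w0 - wstar⟫_ℝ) δ α N
            + effectiveVar) / 2 ∧
      (β * Real.exp (-2) * EMARegression.tailNormSq lam (fun i => ⟪b i, w0 - wstar⟫_ℝ)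
            (EMARegression.kDagger lam δ N) + σ ^ 2) / 2
          * EMARegression.varBracket lam δ α N
        ≤ effectiveVar := by
  have hpos := hsecond.pos
  have hle : ∀ i, δ * lam i ≤ 1 := fun i => by
    have h1 : lam i ≤ lam (EMARegression.Idx.first hd) :=
      hsecond.antitone (Subtype.coe_le_coe.1 i.2.1)
    rw [le_div_iff₀ (hpos _)] at hδ
    exact (mul_le_mul_of_nonneg_left h1 hδ0.le).trans hδ
  have hL := (EMARegression.memLp_errors (δ := δ) (α := α) (w0 := w0) hsecond hfourth hnoise hlaw
    hindep N).1
  have hI := EMARegression.integrable_inner_apply hL (EMARegression.cov D)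
  have hsum := EMARegression.hasSum_integral_inner_sq hsecond hL
  simp_rw [hnoise.risk_eq hsecond.integrable (EMARegression.ema δ α w0 _ N)]
  refine ⟨(integrable_const _).add (hI.const_mul _),
    (∫ ω, ⟪EMARegression.ema δ α w0 (fun t => Z t ω) N - wstar,
      EMARegression.cov D (EMARegression.ema δ α w0 (fun t => Z t ω) N - wstar)⟫_ℝ ∂P)
      - EMARegression.effectiveBias lam (fun i => ⟪b i, w0 - wstar⟫_ℝ) δ α N, ?_, ?_⟩
  · rw [integral_add (integrable_const _) (hI.const_mul _), integral_const_mul, integral_const,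
      probReal_univ, one_smul]
    ring
  set T := EMARegression.tailNormSq lam (fun i => ⟪b i, w0 - wstar⟫_ℝ)
    (EMARegression.kDagger lam δ N) with hT
  have hT0 : 0 ≤ T := tsum_nonneg fun i => by
    have := hpos i
    split_ifs <;> positivity
  have hβ := hfourth.pos
  have hS : 0 ≤ β * Real.exp (-2) * T + σ ^ 2 := by positivity
  -- along each eigendirection: squared mean plus injected variance
  have hcoord : ∀ i, ⟪b i, w0 - wstar⟫_ℝ ^ 2 * lam i * EMARegression.decay δ α N (lam i) ^ 2
      + (β * Real.exp (-2) * T + σ ^ 2) / 2 * EMARegression.varTerm lam δ α N i ≤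
      lam i * ∫ ω, ⟪b i, EMARegression.ema δ α w0 (fun t => Z t ω) N - wstar⟫_ℝ ^ 2 ∂P := by
    intro i
    have h1 := EMARegression.le_comboSq (w0 := w0) (δ := δ) (α := α) hsecond hfourth hnoise hlaw
      hindep i (fun t ht => EMARegression.tailNormSq_le_sgdExcess hsecond hfourth hnoise hlaw
        hindep hδ0 ht) (le_refl N) 1 0
    simp only [EMARegression.comboSq, zero_mul, one_mul, add_zero, ← EMARegression.decay_eq,
      ← hT] at h1
    have h2 := EMARegression.varTerm_le hsecond.antitone hpos hsecond.summable hδ0 hα0 hα1 hN hαN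
      hle i
    refine le_trans ?_ (mul_le_mul_of_nonneg_left h1 (hpos i).le)
    have h3 := mul_le_mul_of_nonneg_left h2 hS
    simp_rw [mul_pow (1 - α)]
    rw [← Finset.mul_sum]
    linarith
  have hterm0 : ∀ i, 0 ≤ EMARegression.varTerm lam δ α N i := fun i => by
    have := hpos i
    have : 0 < 1 - α := by linarith
    unfold EMARegression.varTerm
    split_ifs <;> positivity
  have hbias : Summable fun i =>
      ⟪b i, w0 - wstar⟫_ℝ ^ 2 * lam i * EMARegression.decay δ α N (lam i) ^ 2 := by
    refine Summable.of_nonneg_of_le (fun i => ?_) (fun i => ?_) hsum.summable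
    · have := hpos i
      positivity
    · exact le_trans (le_add_of_nonneg_right (mul_nonneg (by linarith) (hterm0 i))) (hcoord i)
  have hfin := hasSum_le hcoord (hbias.hasSum.add
    ((EMARegression.hasSum_varTerm hpos hsecond.summable hδ0 hα1 N hle).mul_left _)) hsum
  rw [le_sub_iff_add_le']
  exact hfin
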